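/- Let $\mathbb F$ be an algebraically closed field of characteristic $0$, $n\ge 1$, $P_n=\mathbb F[x_1,\dots,x_n]$, and let $W(n)$ be the Lie algebra of all derivations $\sum_i f_i\partial_i$ of $P_n$. Let $S(n)\subseteq W(n)$ be the subalgebra of fields with $\sum_i\partial_i(f_i)=0$, and, for $n=2r$, let $H(n)\subseteq W(n)$ be the subalgebra of fields annihilating the $2$-form $\sum_{i=1}^r dx_i\wedge dx_{i+r}$. Let $\mathfrak g$ be $W(n)$, $S(n)$, or (if $n=2r$ is even) $H(n)$, with its $\mathbb Z$-gradation $\mathfrak g=\bigoplus_{d\ge -1}\mathfrak g_{[d]}$, where $\sum_i f_i\partial_i$ has degree $d$ if all $f_i$ are homogeneous of degree $d+1$; put $\mathfrak g_0=\bigoplus_{d\ge 0}\mathfrak g_{[d]}$ and $\mathfrak g_1=\bigoplus_{d\ge 1}\mathfrak g_{[d]}$, and give $U(\mathfrak g)$ the induced gradation. Let $\mathfrak h\subseteq\mathfrak g_{[0]}$ be the standard Cartan subalgebra, let $\lambda\in\mathfrak h^*$ be an anti-dominant integral weight (that is, $-\lambda$ takes values in $\mathbb Z_{\ge 0}$ on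 the positive coroots of the standard Borel subalgebra), and let $L_0^-(\lambda)$ be the simple $\mathfrak g_{[0]}$-module of lowest weight $\lambda$, with representation $\xi$, regarded also as a $\mathfrak g_0$-module with trivial $\mathfrak g_1$-action. For $i\in\mathbb Z$ let $\nabla(\lambda)_{[i]}$ be the space of all $f\in\operatorname{Hom}_{U(\mathfrak g_0)}(U(\mathfrak g),L_0^-(\lambda))$ with $f(U(\mathfrak g)_{[j]})=0$ for all $j\ne -i$, and let $\nabla(\lambda)=\bigoplus_i\nabla(\lambda)_{[i]}$ be the costandard module, with the action $(x\cdot f)(u)=f(ux)$ of $\mathfrak g$. Let $\mathcal V(\lambda)=P_n\otimes L_0^-(\lambda)$, and for $D=\sum_i f_i\partial_i\in\mathfrak g$ set $$\rho(D)(g\otimes v)=D(g)\otimes v+\sum_{\beta\in\mathbb N^n}x^\beta g\otimes \xi(D_\beta)v,\qquad D_\beta=\sum_{i,j}c_{\beta,i,j}\,x_j\partial_i\in\mathfrak g_{[0]},\qquad \partial_j(f_i)=\sum_\beta c_{\beta,i,j}x^\beta .$$ Then $\rho$ is a representation of the Lie algebra $\mathfrak g$ on $\mathcal V(\lambda)$.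 It is given by the following formulas, in which $x^\gamma=0$ if $\gamma\notin\mathbb N^n$ and $\epsilon_1,\dots,\epsilon_n$ is the standard basis of $\mathbb Z^n$. * For $\mathfrak g=W(n)$: $\rho(\sum_i f_i\partial_i)(g\otimes v)=\sum_i f_i\partial_i(g)\otimes v+\sum_{i,j}\partial_j(f_i)g\otimes\xi(x_j\partial_i)v$. * For $\mathfrak g=S(n)$, $k<l$, $\alpha\in\mathbb N^n$ and $D_{kl}(x^\alpha)=\partial_l(x^\alpha)\partial_k-\partial_k(x^\alpha)\partial_l$: $$\begin{aligned}\rho(D_{kl}(x^\alpha))(g\otimes v)={}&D_{kl}(x^\alpha)(g)\otimes v+\alpha_k\alpha_l x^{\alpha-\epsilon_k-\epsilon_l}g\otimes\xi(x_k\partial_k-x_l\partial_l)v\\&+\sum_{j\ne k}\alpha_l(\alpha_j-\delta_{jl})x^{\alpha-\epsilon_j-\epsilon_l}g\otimes\xi(x_j\partial_k)v-\sum_{j\ne l}\alpha_k(\alpha_j-\delta_{jk})x^{\alpha-\epsilon_j-\epsilon_k}g\otimes\xi(x_j\partial_l)v.\end{aligned}$$ * For $\mathfrak g=H(2r)$,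 $\alpha\in\mathbb N^n$ and $D_H(x^\alpha)=\sum_i\sigma(i)\partial_i(x^\alpha)\partial_{i'}$, where $\sigma(i)=1$, $i'=i+r$ for $i\le r$ and $\sigma(i)=-1$, $i'=i-r$ for $i>r$: $$\begin{aligned}\rho(D_H(x^\alpha))(g\otimes v)={}&D_H(x^\alpha)(g)\otimes v+\sum_{j=1}^{2r}\sigma(j)\alpha_j(\alpha_j-1)x^{\alpha-2\epsilon_j}g\otimes\xi(x_j\partial_{j'})v\\&+\sum_{1\le j<k\le r}\alpha_j\alpha_kx^{\alpha-\epsilon_j-\epsilon_k}g\otimes\xi(x_k\partial_{j'}+x_j\partial_{k'})v\\&-\sum_{k=1}^r\sum_{j=r+1}^{2r}\alpha_j\alpha_kx^{\alpha-\epsilon_j-\epsilon_k}g\otimes\xi(x_k\partial_{j'}-x_j\partial_{k'})v\\&-\sum_{r+1\le j<k\le 2r}\alpha_j\alpha_kx^{\alpha-\epsilon_j-\epsilon_k}g\otimes\xi(x_k\partial_{j'}+x_j\partial_{k'})v.\end{aligned}$$ Moreover $\mathcal V(\lambda)\cong\nabla(\lambda)$ as $\mathfrak g$-modules (equivalently,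 as $U(\mathfrak g)$-modules): there is an isomorphism of $\mathfrak g$-modules $\psi:\mathcal V(\lambda)\to\nabla(\lambda)$ such that, for all $f\in P_n$, $v\in L_0^-(\lambda)$ and $a\in\mathbb N^n$, $$\psi(f\otimes v)(\partial_1^{a_1}\cdots\partial_n^{a_n})=\bigl(\partial_1^{a_1}\cdots\partial_n^{a_n}(f)\bigr)(0)\,v .$$ -/

import Mathlib

open MvPolynomial
open scoped TensorProduct

attribute [local instance 100] LieRing.ofAssociativeRing

namespace CartanVF

noncomputable section

/-- The three series of Lie algebras of vector fields. -/
inductive CartanType : Type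
  | W
  | S
  | H

/-- The polynomial algebra `P_n = F[x_1, …, x_n]` (variables indexed by `Fin n`). -/
abbrev Poly (F : Type*) [Field F] (n : ℕ) : Type _ := MvPolynomial (Fin n) F

/-- The Lie algebra of all derivations of `P_n`, with the commutator bracket. -/
abbrev Der (F : Type*) [Field F] (n : ℕ) : Type _ := Derivation F (Poly F n) (Poly F n)

section Basic

variable (F : Type*) [Field F] (n : ℕ)

/-- The divergence `∑ ∂_i(f_i)` of `∑ f_i ∂_i`, where `f_i = D(x_i)`. -/
def divergence (D : Der F n) : Poly F n := ∑ i, pderiv i (D (X i))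

/-- The partner index: for `n = 2r`, it is `i + r` for `i` in the first half of the indices
and `i - r` for `i` in the second half. -/
def partner {n : ℕ} (i : Fin n) : Fin n :=
  if h : i.val + n / 2 < n then ⟨i.val + n / 2, h⟩ else ⟨i.val - n / 2, by omega⟩

/-- `i` lies in the first half of the indices. -/
def IsFirst {n : ℕ} (i : Fin n) : Prop := i.val < n / 2

instance {n : ℕ} (i : Fin n) : Decidable (IsFirst i) :=
  inferInstanceAs (Decidable (i.val < n / 2))

/-- The sign `σ(i)`: `1` on the first half of the indices and `-1` on the second half. -/
def sgn {n : ℕ} (i : Fin n) : F := if IsFirst i then 1 else -1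

variable {F n}

/-- The value of the `2`-form `∑_{i ≤ r} dx_i ∧ dx_{i+r}` at two vector fields, for `n = 2r`. -/
def symplecticForm (A B : Der F n) : Poly F n :=
  ∑ i, sgn F i • (A (X i) * B (X (partner i)))

/-- The Lie derivative along `D` of the `2`-form, evaluated at two vector fields. -/
def lieDerivSymplecticForm (D A B : Der F n) : Poly F n :=
  D (symplecticForm A B) - symplecticForm ⁅D, A⁆ B - symplecticForm A ⁅D, B⁆

theorem der_sum_apply {ι : Type*} (s : Finset ι) (f : ι → Der F n) (p : Poly F n) :
    (∑ i ∈ s, f i) p = ∑ i ∈ s, f i p := by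
  have h : ⇑(∑ i ∈ s, f i) = ∑ i ∈ s, ⇑(f i) := map_sum Derivation.coeFnAddMonoidHom f s
  rw [h, Finset.sum_apply]

/-- Every derivation is `∑ f_i ∂_i` with `f_i = D(x_i)`. -/
theorem der_apply (D : Der F n) (p : Poly F n) : D p = ∑ i, D (X i) * pderiv i p := by
  have h : D = ∑ i, D (X i) • (pderiv i : Der F n) := by
    apply derivation_ext
    intro j
    simp [der_sum_apply, pderiv_X, Pi.single_apply]
  conv_lhs => rw [h]
  simp [der_sum_apply]

theorem pderiv_comm' (i j : Fin n) (p : Poly F n) :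
    pderiv i (pderiv j p) = pderiv j (pderiv i p) := by
  have h : ⁅(pderiv i : Der F n), (pderiv j : Der F n)⁆ = 0 := by
    apply derivation_ext
    intro k
    simp only [Derivation.commutator_apply, pderiv_X, Derivation.zero_apply]
    by_cases h1 : j = k <;> by_cases h2 : i = k <;> simp [h1, h2]
  have := congrArg (fun D : Der F n => D p) h
  simpa [Derivation.commutator_apply, sub_eq_zero] using this

theorem divergence_lie (D E : Der F n) :
    divergence F n ⁅D, E⁆ = D (divergence F n E) - E (divergence F n D) := by
  have key : ∀ A B : Der F n, ∑ i, pderiv i (A (B (X i))) =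
      (∑ i, ∑ j, pderiv i (A (X j)) * pderiv j (B (X i))) + A (divergence F n B) := by
    intro A B
    unfold divergence
    rw [map_sum, ← Finset.sum_add_distrib]
    refine Finset.sum_congr rfl fun i _ => ?_
    rw [der_apply A (B (X i)), der_apply A (pderiv i (B (X i))), map_sum,
      ← Finset.sum_add_distrib]
    refine Finset.sum_congr rfl fun j _ => ?_
    rw [pderiv_mul, pderiv_comm' i j]
  have h : divergence F n ⁅D, E⁆ =
      ∑ i, pderiv i (D (E (X i))) - ∑ i, pderiv i (E (D (X i))) := by
    simp [divergence, Derivation.commutator_apply, Finset.sum_sub_distrib]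
  rw [h, key, key, Finset.sum_comm]
  simp only [mul_comm (pderiv _ (E _))]
  ring

theorem symplecticForm_add_left (A A' B : Der F n) :
    symplecticForm (A + A') B = symplecticForm A B + symplecticForm A' B := by
  simp [symplecticForm, add_mul, Finset.sum_add_distrib]

theorem symplecticForm_sub_left (A A' B : Der F n) :
    symplecticForm (A - A') B = symplecticForm A B - symplecticForm A' B := by
  simp [symplecticForm, sub_mul, smul_sub, Finset.sum_sub_distrib]

theorem symplecticForm_sub_right (A B B' : Der F n) :
    symplecticForm A (B - B') = symplecticForm A B - symplecticForm A B' := by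
  simp [symplecticForm, mul_sub, smul_sub, Finset.sum_sub_distrib]

theorem lieDeriv_lie (D E A B : Der F n)
    (hD : ∀ A B : Der F n, lieDerivSymplecticForm D A B = 0)
    (hE : ∀ A B : Der F n, lieDerivSymplecticForm E A B = 0) :
    lieDerivSymplecticForm ⁅D, E⁆ A B = 0 := by
  have hD' : ∀ A B : Der F n,
      D (symplecticForm A B) = symplecticForm ⁅D, A⁆ B + symplecticForm A ⁅D, B⁆ := by
    intro A B; have := hD A B; unfold lieDerivSymplecticForm at this; linear_combination this
  have hE' : ∀ A B : Der F n,
      E (symplecticForm A B) = symplecticForm ⁅E, A⁆ B + symplecticForm A ⁅E, B⁆ := by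
    intro A B; have := hE A B; unfold lieDerivSymplecticForm at this; linear_combination this
  unfold lieDerivSymplecticForm
  rw [Derivation.commutator_apply, hE', hD', map_add, map_add, hD', hD', hE', hE',
    lie_lie D E A, lie_lie D E B, symplecticForm_sub_left, symplecticForm_sub_right]
  ring

theorem lieDeriv_eq (D A B : Der F n) :
    lieDerivSymplecticForm D A B = ∑ i, sgn F i •
      (A (D (X i)) * B (X (partner i)) + A (X i) * B (D (X (partner i)))) := by
  unfold lieDerivSymplecticForm symplecticForm
  rw [map_sum, ← Finset.sum_sub_distrib, ← Finset.sum_sub_distrib]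
  refine Finset.sum_congr rfl fun i _ => ?_
  simp only [Derivation.map_smul, Derivation.leibniz, Derivation.commutator_apply, smul_eq_mul,
    ← smul_sub]
  congr 1
  ring

/-- It is enough to test the Lie derivative on the coordinate vector fields. -/
theorem lieDeriv_eq_zero_iff (D : Der F n) :
    (∀ A B : Der F n, lieDerivSymplecticForm D A B = 0) ↔
      ∀ j k : Fin n, ∑ i, sgn F i • (pderiv j (D (X i)) * pderiv k (X (partner i)) +
        pderiv j (X i) * pderiv k (D (X (partner i)))) = 0 := by
  constructor
  · intro h j k
    rw [← lieDeriv_eq]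
    exact h _ _
  · intro h A B
    rw [lieDeriv_eq]
    have : ∑ i, sgn F i •
        (A (D (X i)) * B (X (partner i)) + A (X i) * B (D (X (partner i)))) =
        ∑ j, ∑ k, A (X j) * B (X k) *
          ∑ i, sgn F i • (pderiv j (D (X i)) * pderiv k (X (partner i)) +
            pderiv j (X i) * pderiv k (D (X (partner i)))) := by
      simp only [Finset.mul_sum]
      have e : ∀ i : Fin n, sgn F i •
          (A (D (X i)) * B (X (partner i)) + A (X i) * B (D (X (partner i)))) =
          ∑ j, ∑ k, A (X j) * B (X k) * (sgn F i • (pderiv j (D (X i)) * pderiv k (X (partner i)) +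
            pderiv j (X i) * pderiv k (D (X (partner i))))) := by
        intro i
        rw [der_apply A (D (X i)), der_apply B (X (partner i)), der_apply A (X i),
          der_apply B (D (X (partner i))), Finset.sum_mul_sum, Finset.sum_mul_sum,
          ← Finset.sum_add_distrib, Finset.smul_sum]
        refine Finset.sum_congr rfl fun j _ => ?_
        rw [← Finset.sum_add_distrib, Finset.smul_sum]
        refine Finset.sum_congr rfl fun k _ => ?_
        rw [mul_smul_comm]
        congr 1
        ring
      rw [Finset.sum_congr rfl fun i _ => e i, Finset.sum_comm]
      refine Finset.sum_congr rfl fun j _ => ?_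
      rw [Finset.sum_comm]
    rw [this]
    simp only [h, mul_zero, Finset.sum_const_zero]

variable (F n)

/-- The Lie algebras `W(n)` (all vector fields), `S(n)` (divergence zero) and `H(n)` (vector
fields annihilating the `2`-form; meant for even `n`), as subalgebras of the derivations. -/
def vf : CartanType → LieSubalgebra F (Der F n)
  | .W => ⊤
  | .S =>
    { carrier := {D | divergence F n D = 0}
      zero_mem' := by simp [divergence]
      add_mem' := by
        intro a b ha hb
        change divergence F n a = 0 at ha
        change divergence F n b = 0 at hb
        change divergence F n (a + b) = 0
        unfold divergence at *
        simp [Finset.sum_add_distrib, ha, hb]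
      smul_mem' := by
        intro c a ha
        change divergence F n a = 0 at ha
        change divergence F n (c • a) = 0
        unfold divergence at *
        simp [← Finset.smul_sum, ha]
      lie_mem' := by
        intro a b ha hb
        change divergence F n ⁅a, b⁆ = 0
        change divergence F n a = 0 at ha
        change divergence F n b = 0 at hb
        rw [divergence_lie, ha, hb]; simp }
  | .H =>
    { carrier := {D | ∀ A B : Der F n, lieDerivSymplecticForm D A B = 0}
      zero_mem' := by intro A B; rw [lieDeriv_eq]; simp
      add_mem' := by
        intro a b ha hb A B
        have h1 := ha A B
        have h2 := hb A B
        rw [lieDeriv_eq] at *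
        rw [← add_zero (0 : Poly F n)]
        nth_rw 1 [← h1]
        rw [← h2, ← Finset.sum_add_distrib]
        refine Finset.sum_congr rfl fun i _ => ?_
        rw [← smul_add]
        simp only [Derivation.add_apply, map_add]
        congr 1
        ring
      smul_mem' := by
        intro c a ha A B
        have h1 := ha A B
        rw [lieDeriv_eq] at *
        rw [← smul_zero c, ← h1, Finset.smul_sum]
        refine Finset.sum_congr rfl fun i _ => ?_
        rw [smul_comm c]
        simp only [Derivation.smul_apply, Derivation.map_smul, smul_add, smul_mul_assoc,
          mul_smul_comm]
      lie_mem' := by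
        intro a b ha hb A B
        exact lieDeriv_lie a b A B ha hb }

variable {F n}

theorem mem_W (D : Der F n) : D ∈ vf F n .W := LieSubalgebra.mem_top D

theorem mem_S (D : Der F n) : D ∈ vf F n .S ↔ divergence F n D = 0 := Iff.rfl

theorem mem_H (D : Der F n) :
    D ∈ vf F n .H ↔ ∀ A B : Der F n, lieDerivSymplecticForm D A B = 0 := Iff.rfl

/-- Membership in `W(n)`, `S(n)`, `H(n)` is a condition with constant coefficients on the
Jacobian matrix, so it is preserved by linear maps applied to the Jacobian matrix. -/
theorem mem_vf_of_pderiv (T : CartanType) (D E : Der F n) (φ : Poly F n →ₗ[F] Poly F n)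
    (h : ∀ i j : Fin n, pderiv j (E (X i)) = φ (pderiv j (D (X i)))) (hD : D ∈ vf F n T) :
    E ∈ vf F n T := by
  cases T with
  | W => exact mem_W E
  | S =>
    rw [mem_S] at *
    unfold divergence at *
    simp only [h]
    rw [← map_sum, hD, map_zero]
  | H =>
    rw [mem_H, lieDeriv_eq_zero_iff] at *
    intro j k
    rw [← map_zero φ, ← hD j k, map_sum]
    refine Finset.sum_congr rfl fun i _ => ?_
    rw [map_smul, map_add, h, h, pderiv_X, pderiv_X]
    by_cases h1 : k = partner i <;> by_cases h2 : j = i <;> simp [h1, h2, eq_comm]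

/-! ### Gradation and filtration -/

theorem coeff_der_ne_zero (D E : Der F n) (i : Fin n) (m : Fin n →₀ ℕ)
    (h : coeff m (D (E (X i))) ≠ 0) : ∃ (j : Fin n) (a b : Fin n →₀ ℕ), a + b = m ∧
      coeff a (D (X j)) ≠ 0 ∧ coeff (b + Finsupp.single j 1) (E (X i)) ≠ 0 := by
  rw [der_apply, coeff_sum] at h
  obtain ⟨j, _, hj⟩ := Finset.exists_ne_zero_of_sum_ne_zero h
  rw [coeff_mul] at hj
  obtain ⟨⟨a, b⟩, hab, hne⟩ := Finset.exists_ne_zero_of_sum_ne_zero hj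
  rw [Finset.HasAntidiagonal.mem_antidiagonal] at hab
  rw [coeff_pderiv] at hne
  exact ⟨j, a, b, hab, left_ne_zero_of_mul hne,
    left_ne_zero_of_mul (right_ne_zero_of_mul hne)⟩

variable (F n) in
/-- The vector fields of degree `d`: all `f_i` are homogeneous of degree `d + 1`. -/
def derGrade (d : ℤ) : Submodule F (Der F n) where
  carrier := {D | ∀ i m, coeff m (D (X i)) ≠ 0 → (m.degree : ℤ) = d + 1}
  zero_mem' := by intro i m h; simp at h
  add_mem' := by
    intro a b ha hb i m h
    by_cases h1 : coeff m (a (X i)) = 0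
    · refine hb i m fun h2 => h ?_
      rw [Derivation.add_apply, coeff_add, h1, h2, add_zero]
    · exact ha i m h1
  smul_mem' := by
    intro c a ha i m h
    refine ha i m fun h1 => h ?_
    rw [Derivation.smul_apply, coeff_smul, h1, smul_zero]

theorem lie_mem_derGrade {d e : ℤ} {D E : Der F n} (hD : D ∈ derGrade F n d)
    (hE : E ∈ derGrade F n e) : ⁅D, E⁆ ∈ derGrade F n (d + e) := by
  have key : ∀ {d e : ℤ} {D E : Der F n}, D ∈ derGrade F n d → E ∈ derGrade F n e →
      ∀ i m, coeff m (D (E (X i))) ≠ 0 → (m.degree : ℤ) = d + e + 1 := by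
    intro d e D E hD hE i m h
    obtain ⟨j, a, b, rfl, ha, hb⟩ := coeff_der_ne_zero D E i m h
    have h1 := hD j a ha
    have h2 := hE i _ hb
    simp only [map_add, Finsupp.degree_single, Nat.cast_add, Nat.cast_one] at h1 h2 ⊢
    omega
  intro i m h
  rw [Derivation.commutator_apply, coeff_sub] at h
  by_cases h1 : coeff m (D (E (X i))) = 0
  · rw [h1, zero_sub, neg_ne_zero] at h
    have := key hE hD i m h
    omega
  · exact key hD hE i m h1

variable (F n) in
/-- The graded piece `g_[d]` of `g = W(n), S(n), H(n)`. -/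
def grade (T : CartanType) (d : ℤ) : Submodule F (vf F n T) :=
  (derGrade F n d).comap (vf F n T).toSubmodule.subtype

variable (F n) in
/-- The Lie subalgebra `g_[0]` of `g`. -/
def gradeZero (T : CartanType) : LieSubalgebra F (vf F n T) :=
  { grade F n T 0 with
    lie_mem' := by
      intro x y hx hy
      have := lie_mem_derGrade (F := F) (n := n) hx hy
      rwa [add_zero] at this }

theorem mem_gradeZero {T : CartanType} {x : vf F n T} (h : x.1 ∈ derGrade F n 0) :
    x ∈ gradeZero F n T := h

variable (F n) in
/-- The Lie subalgebra `g_0`, the sum of the graded pieces of degree `≥ 0`: all `f_i` have zero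
constant term. -/
def filtZero (T : CartanType) : LieSubalgebra F (vf F n T) where
  carrier := {D | ∀ i, coeff 0 (D.1 (X i)) = 0}
  zero_mem' := by intro i; simp
  add_mem' := by
    intro a b ha hb i
    have h1 := ha i
    have h2 := hb i
    simp [h1, h2]
  smul_mem' := by
    intro c a ha i
    have h1 := ha i
    simp [h1]
  lie_mem' := by
    intro x y hx hy i
    have key : ∀ D E : Der F n, (∀ j, coeff 0 (D (X j)) = 0) → coeff 0 (D (E (X i))) = 0 := by
      intro D E hD
      by_contra h
      obtain ⟨j, a, b, hab, ha, _⟩ := coeff_der_ne_zero D E i 0 h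
      have : a = 0 := (add_eq_zero.mp hab).1
      exact ha (this ▸ hD j)
    change coeff 0 (⁅x.1, y.1⁆ (X i)) = 0
    rw [Derivation.commutator_apply, coeff_sub, key _ _ hx, key _ _ hy, sub_zero]

/-- The component of degree `k - 1` of a vector field. -/
def derComp (k : ℕ) (D : Der F n) : Der F n :=
  mkDerivation F fun i => homogeneousComponent k (D (X i))

theorem pderiv_homogeneousComponent (j : Fin n) (k : ℕ) (p : Poly F n) :
    pderiv j (homogeneousComponent k p) =
      (if k = 0 then 0 else homogeneousComponent (k - 1) : Poly F n →ₗ[F] Poly F n)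
        (pderiv j p) := by
  ext m
  rw [coeff_pderiv, coeff_homogeneousComponent]
  rcases k with _ | k
  · simp
  · simp only [map_add, Finsupp.degree_single, Nat.add_right_cancel_iff, Nat.succ_ne_zero,
      if_false, Nat.add_sub_cancel, coeff_homogeneousComponent, coeff_pderiv]
    split_ifs <;> simp

theorem derComp_mem_vf (T : CartanType) (k : ℕ) (D : Der F n) (hD : D ∈ vf F n T) :
    derComp k D ∈ vf F n T := by
  refine mem_vf_of_pderiv T D _
    (if k = 0 then 0 else homogeneousComponent (k - 1)) (fun i j => ?_) hD
  rw [derComp, mkDerivation_X, pderiv_homogeneousComponent]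

/-- The component of degree `k - 1` of an element of `g`. -/
def comp (T : CartanType) (k : ℕ) (x : vf F n T) : vf F n T :=
  ⟨derComp k x.1, derComp_mem_vf T k x.1 x.2⟩

theorem comp_mem_grade (T : CartanType) (k : ℕ) (x : vf F n T) :
    comp T k x ∈ grade F n T ((k : ℤ) - 1) := by
  intro i m h
  change coeff m (derComp k x.1 (X i)) ≠ 0 at h
  rw [derComp, mkDerivation_X, coeff_homogeneousComponent] at h
  have : m.degree = k := by by_contra h1; simp [h1] at h
  omega

theorem exists_sum_comp (T : CartanType) (x : vf F n T) :
    ∃ N : ℕ, x = ∑ k ∈ Finset.range N, comp T k x := by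
  refine ⟨(Finset.univ.sup fun i => (x.1 (X i)).totalDegree) + 1, ?_⟩
  apply Subtype.ext
  rw [AddSubmonoidClass.coe_finsetSum]
  apply derivation_ext
  intro i
  rw [der_sum_apply]
  ext m
  rw [coeff_sum]
  have : ∀ k : ℕ, coeff m ((comp T k x).1 (X i)) =
      if m.degree = k then coeff m (x.1 (X i)) else 0 := by
    intro k
    change coeff m (derComp k x.1 (X i)) = _
    rw [derComp, mkDerivation_X, coeff_homogeneousComponent]
  simp only [this]
  rw [Finset.sum_ite_eq]
  split_ifs with h
  · rfl
  · by_contra h1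
    apply h
    rw [Finset.mem_range, Nat.lt_succ_iff]
    refine le_trans ?_ (Finset.le_sup (f := fun i => (x.1 (X i)).totalDegree) (Finset.mem_univ i))
    have := le_totalDegree (mem_support_iff.mpr h1)
    rwa [Finsupp.degree_eq_sum, ← Finsupp.sum_fintype m (fun _ e => e) (fun _ => rfl)]

/-! ### Linear parts -/

/-- For `D = ∑ f_i ∂_i` and an exponent `β`, the linear vector field
`∑_{i,j} c_{ij} x_j ∂_i`, where `c_{ij}` is the coefficient of `x^β` in `∂_j(f_i)`. -/
def derLin (β : Fin n →₀ ℕ) (D : Der F n) : Der F n :=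
  mkDerivation F fun i => ∑ j, C (coeff β (pderiv j (D (X i)))) * X j

theorem derLin_X (β : Fin n →₀ ℕ) (D : Der F n) (i : Fin n) :
    derLin β D (X i) = ∑ j, C (coeff β (pderiv j (D (X i)))) * X j := by
  rw [derLin, mkDerivation_X]

theorem pderiv_derLin (β : Fin n →₀ ℕ) (D : Der F n) (i j : Fin n) :
    pderiv j (derLin β D (X i)) = C (coeff β (pderiv j (D (X i)))) := by
  rw [derLin_X, map_sum]
  simp [pderiv_X, Pi.single_apply]

theorem derLin_mem_vf (T : CartanType) (β : Fin n →₀ ℕ) (D : Der F n) (hD : D ∈ vf F n T) :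
    derLin β D ∈ vf F n T := by
  refine mem_vf_of_pderiv T D _ ((Algebra.linearMap F (Poly F n)) ∘ₗ lcoeff F β)
    (fun i j => ?_) hD
  rw [pderiv_derLin]
  rfl

theorem derLin_mem_derGrade (β : Fin n →₀ ℕ) (D : Der F n) : derLin β D ∈ derGrade F n 0 := by
  intro i m h
  rw [derLin_X, coeff_sum] at h
  obtain ⟨j, _, hj⟩ := Finset.exists_ne_zero_of_sum_ne_zero h
  rw [coeff_C_mul, coeff_X] at hj
  have : Finsupp.single j 1 = m := by by_contra h1; simp [h1] at hj
  rw [← this]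
  simp

/-- The linear vector field `derLin β x`, as an element of `g_[0]`. -/
def lin (T : CartanType) (β : Fin n →₀ ℕ) (x : vf F n T) : gradeZero F n T :=
  ⟨⟨derLin β x.1, derLin_mem_vf T β x.1 x.2⟩, derLin_mem_derGrade β x.1⟩

theorem coeff_zero_pderiv_lie (D E : Der F n) (hD : ∀ j, coeff 0 (D (X j)) = 0) (i j : Fin n) :
    coeff 0 (pderiv j (D (E (X i)))) =
      ∑ k, coeff 0 (pderiv j (D (X k))) * coeff 0 (pderiv k (E (X i))) := by
  have e : ∀ p : Poly F n, coeff 0 p = constantCoeff p := fun _ => rfl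
  simp only [e] at *
  rw [der_apply D (E (X i)), map_sum, map_sum]
  refine Finset.sum_congr rfl fun k _ => ?_
  rw [pderiv_mul, map_add, map_mul, map_mul, hD k, zero_mul, add_zero]

theorem derLin_derLin_X (D E : Der F n) (i : Fin n) :
    derLin 0 D (derLin 0 E (X i)) = ∑ j, C (∑ k, coeff 0 (pderiv j (D (X k))) *
      coeff 0 (pderiv k (E (X i)))) * X j := by
  have : ∀ k, derLin 0 D (C (coeff 0 (pderiv k (E (X i)))) * X k) =
      ∑ j, C (coeff 0 (pderiv j (D (X k))) * coeff 0 (pderiv k (E (X i)))) * X j := by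
    intro k
    rw [C_mul', Derivation.map_smul, derLin_X, smul_eq_C_mul, Finset.mul_sum]
    refine Finset.sum_congr rfl fun j _ => ?_
    rw [C_mul]
    ring
  rw [derLin_X 0 E, map_sum]
  simp only [this]
  rw [Finset.sum_comm]
  refine Finset.sum_congr rfl fun j _ => ?_
  rw [map_sum, Finset.sum_mul]

variable (F n) in
/-- The projection of `g_0` onto `g_[0]` along the graded pieces of degree `≥ 1`: a vector field
with zero constant terms is sent to its linear part. -/
def projZero (T : CartanType) : filtZero F n T →ₗ⁅F⁆ gradeZero F n T where
  toFun x := lin T 0 x.1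
  map_add' x y := by
    apply Subtype.ext; apply Subtype.ext; apply derivation_ext; intro i
    change derLin 0 (x.1.1 + y.1.1) (X i) = derLin 0 x.1.1 (X i) + derLin 0 y.1.1 (X i)
    simp only [derLin_X, Derivation.add_apply, map_add, coeff_add, add_mul,
      Finset.sum_add_distrib]
  map_smul' c x := by
    apply Subtype.ext; apply Subtype.ext; apply derivation_ext; intro i
    change derLin 0 (c • x.1.1) (X i) = c • derLin 0 x.1.1 (X i)
    simp only [derLin_X, Derivation.smul_apply, Derivation.map_smul, coeff_smul, smul_eq_mul,
      Finset.smul_sum, C_mul, mul_assoc]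
    simp only [smul_eq_C_mul]
  map_lie' := by
    intro x y
    apply Subtype.ext; apply Subtype.ext; apply derivation_ext; intro i
    change derLin 0 ⁅x.1.1, y.1.1⁆ (X i) = ⁅derLin 0 x.1.1, derLin 0 y.1.1⁆ (X i)
    rw [Derivation.commutator_apply, derLin_derLin_X, derLin_derLin_X, derLin_X,
      ← Finset.sum_sub_distrib]
    refine Finset.sum_congr rfl fun j _ => ?_
    rw [Derivation.commutator_apply, map_sub, coeff_sub, coeff_zero_pderiv_lie _ _ x.2,
      coeff_zero_pderiv_lie _ _ y.2, C_sub, sub_mul]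

/-! ### Weights -/

variable (F n) in
/-- The subalgebra `n⁻` of `g_[0]`, as a space of vector fields. -/
def nMinus : CartanType → Submodule F (Der F n)
  | .H => Submodule.span F
      ({D | ∃ i j : Fin n, j < i ∧ IsFirst i ∧
          D = (X i : Poly F n) • pderiv j - (X (partner j) : Poly F n) • pderiv (partner i)} ∪
        {D | ∃ s t : Fin n, s ≤ t ∧ IsFirst t ∧
          D = (X (partner s) : Poly F n) • pderiv t + (X (partner t) : Poly F n) • pderiv s})
  | _ => Submodule.span F {D | ∃ i j : Fin n, j < i ∧ D = (X i : Poly F n) • pderiv j}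

variable (F) in
/-- The vector field `x_i ∂_i`. -/
def euler (i : Fin n) : Der F n := (X i : Poly F n) • pderiv i

variable (F n) in
/-- The Cartan subalgebra `h` of `g_[0]`, as a space of vector fields. -/
def cartan : CartanType → Submodule F (Der F n)
  | .W => Submodule.span F {D | ∃ i : Fin n, D = euler F i}
  | .S => Submodule.span F {D | ∃ i j : Fin n, i < j ∧ D = euler F i - euler F j}
  | .H => Submodule.span F
      {D | ∃ i : Fin n, IsFirst i ∧ D = euler F i - euler F (partner i)}

variable (F n) in
/-- The coroots of the positive roots of `g_[0]`, the positive system being the one of the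
standard Borel subalgebra `h + n⁺`. -/
def posCoroots : CartanType → Set (Der F n)
  | .H => {D | ∃ i j : Fin n, i < j ∧ IsFirst j ∧ (D =
          (euler F i - euler F (partner i)) - (euler F j - euler F (partner j)) ∨ D =
          (euler F i - euler F (partner i)) + (euler F j - euler F (partner j)))} ∪
        {D | ∃ i : Fin n, IsFirst i ∧ D = euler F i - euler F (partner i)}
  | _ => {D | ∃ i j : Fin n, i < j ∧ D = euler F i - euler F j}

/-- Anti-dominant integral weights: `-λ` takes values in `ℕ` on the positive coroots. -/
def IsAntidominant (T : CartanType) (lam : Module.Dual F (cartan F n T)) : Prop :=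
  ∀ h : cartan F n T, (h : Der F n) ∈ posCoroots F n T → ∃ m : ℕ, lam h = -(m : F)

/-- `L` contains a lowest weight vector of weight `λ`: a nonzero vector that is killed by `n⁻` and
on which `h` acts by `λ`. -/
def HasLowestWeight (T : CartanType) (lam : Module.Dual F (cartan F n T)) (L : Type*)
    [AddCommGroup L] [Module F L] [LieRingModule (gradeZero F n T) L] : Prop :=
  ∃ v : L, v ≠ 0 ∧
    (∀ x : gradeZero F n T, (x.1 : Der F n) ∈ nMinus F n T → ⁅x, v⁆ = 0) ∧
    ∀ (x : gradeZero F n T) (hx : (x.1 : Der F n) ∈ cartan F n T), ⁅x, v⁆ = lam ⟨x.1, hx⟩ • v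

/-! ### The costandard module -/

variable (F n) in
/-- The universal enveloping algebra `U(g)`. -/
abbrev U (T : CartanType) : Type _ := UniversalEnvelopingAlgebra F (vf F n T)

variable (F n) in
/-- The gradation of `U(g)` induced by that of `g`: the piece of degree `d` is spanned by the
products `x_1 ⋯ x_k` of homogeneous elements of `g` whose degrees add up to `d`. -/
def uGrade (T : CartanType) (d : ℤ) : Submodule F (U F n T) :=
  Submodule.span F {u | ∃ l : List (ℤ × vf F n T), (∀ p ∈ l, p.2 ∈ grade F n T p.1) ∧
    (l.map Prod.fst).sum = d ∧ u = (l.map fun p => UniversalEnvelopingAlgebra.ι F p.2).prod}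

theorem mul_ι_mem_uGrade (T : CartanType) {d e : ℤ} {u : U F n T} {x : vf F n T}
    (hu : u ∈ uGrade F n T d) (hx : x ∈ grade F n T e) :
    u * UniversalEnvelopingAlgebra.ι F x ∈ uGrade F n T (d + e) := by
  induction hu using Submodule.span_induction with
  | mem u hu =>
    obtain ⟨l, h1, h2, rfl⟩ := hu
    refine Submodule.subset_span ⟨l ++ [(e, x)], ?_, ?_, ?_⟩
    · intro p hp
      rcases List.mem_append.mp hp with hp | hp
      · exact h1 p hp
      · rw [List.mem_singleton.mp hp]; exact hx
    · simp [h2]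
    · simp
  | zero => rw [zero_mul]; exact zero_mem _
  | add a b _ _ ha hb => rw [add_mul]; exact add_mem ha hb
  | smul c a _ ha => rw [smul_mul_assoc]; exact Submodule.smul_mem _ _ ha

variable (F n) in
/-- The map `U(g_0) → U(g)` induced by the inclusion. -/
def uIncl (T : CartanType) : UniversalEnvelopingAlgebra F (filtZero F n T) →ₐ[F] U F n T :=
  UniversalEnvelopingAlgebra.lift F
    ((UniversalEnvelopingAlgebra.ι F).comp (filtZero F n T).incl)

section Modules

variable (T : CartanType) (L : Type*) [AddCommGroup L] [Module F L]
  [LieRingModule (gradeZero F n T) L] [LieModule F (gradeZero F n T) L]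

variable (F n) in
/-- The action of `U(g_0)` on a `g_[0]`-module `L`, regarded as a `g_0`-module on which the graded
pieces of degree `≥ 1` act by zero. -/
def uRep : UniversalEnvelopingAlgebra F (filtZero F n T) →ₐ[F] Module.End F L :=
  UniversalEnvelopingAlgebra.lift F
    ((LieModule.toEnd F (gradeZero F n T) L).comp (projZero F n T))

variable (F n) in
/-- The space of `U(g_0)`-linear maps `U(g) → L` that vanish on all graded pieces of `U(g)` except
that of degree `-i`. -/
def costandardGrade (i : ℤ) : Submodule F (U F n T →ₗ[F] L) where
  carrier := {f | (∀ a u, f (uIncl F n T a * u) = uRep F n T L a (f u)) ∧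
    ∀ j : ℤ, j ≠ -i → ∀ u ∈ uGrade F n T j, f u = 0}
  zero_mem' := by constructor <;> simp
  add_mem' := by
    rintro f g ⟨hf1, hf2⟩ ⟨hg1, hg2⟩
    refine ⟨fun a u => ?_, fun j hj u hu => ?_⟩
    · simp [hf1, hg1]
    · simp [hf2 j hj u hu, hg2 j hj u hu]
  smul_mem' := by
    rintro c f ⟨hf1, hf2⟩
    refine ⟨fun a u => ?_, fun j hj u hu => ?_⟩
    · simp [hf1]
    · simp [hf2 j hj u hu]

variable (F n) in
/-- The underlying space of the costandard module: the sum of the graded pieces. -/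
def costandard : Submodule F (U F n T →ₗ[F] L) := ⨆ i : ℤ, costandardGrade F n T L i

theorem comp_mulRight_mem (x : vf F n T) (f : U F n T →ₗ[F] L) (hf : f ∈ costandard F n T L) :
    f ∘ₗ LinearMap.mulRight F (UniversalEnvelopingAlgebra.ι F x) ∈ costandard F n T L := by
  have key : costandard F n T L ≤ (costandard F n T L).comap
      (LinearMap.lcomp F L (LinearMap.mulRight F (UniversalEnvelopingAlgebra.ι F x))) := by
    refine iSup_le fun i g hg => ?_
    change g ∘ₗ LinearMap.mulRight F (UniversalEnvelopingAlgebra.ι F x) ∈ costandard F n T L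
    obtain ⟨N, hN⟩ := exists_sum_comp T x
    have e : g ∘ₗ LinearMap.mulRight F (UniversalEnvelopingAlgebra.ι F x) =
        ∑ k ∈ Finset.range N,
          g ∘ₗ LinearMap.mulRight F (UniversalEnvelopingAlgebra.ι F (comp T k x)) := by
      ext u
      conv_lhs => rw [hN]
      simp [LinearMap.sum_apply, Finset.mul_sum]
    rw [e]
    refine Submodule.sum_mem _ fun k _ => ?_
    refine Submodule.mem_iSup_of_mem (i + ((k : ℤ) - 1)) ⟨fun a u => ?_, fun j hj u hu => ?_⟩
    · simp only [LinearMap.comp_apply, LinearMap.mulRight_apply, mul_assoc]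
      exact hg.1 _ _
    · simp only [LinearMap.comp_apply, LinearMap.mulRight_apply]
      refine hg.2 (j + ((k : ℤ) - 1)) (fun h => hj ?_) _
        (mul_ι_mem_uGrade T hu (comp_mem_grade T k x))
      omega
  exact key hf

/-- The action of `g` on the costandard module: `(x f)(u) = f(u x)`. -/
instance : LieRingModule (vf F n T) (costandard F n T L) where
  bracket x f := ⟨f.1 ∘ₗ LinearMap.mulRight F (UniversalEnvelopingAlgebra.ι F x),
    comp_mulRight_mem T L x f.1 f.2⟩
  add_lie x y f := by
    apply Subtype.ext; apply LinearMap.ext; intro u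
    change f.1 (u * UniversalEnvelopingAlgebra.ι F (x + y)) =
      f.1 (u * UniversalEnvelopingAlgebra.ι F x) + f.1 (u * UniversalEnvelopingAlgebra.ι F y)
    rw [map_add, mul_add, map_add]
  lie_add x f g := rfl
  leibniz_lie x y f := by
    apply Subtype.ext; apply LinearMap.ext; intro u
    change f.1 (u * UniversalEnvelopingAlgebra.ι F x * UniversalEnvelopingAlgebra.ι F y) =
      f.1 (u * UniversalEnvelopingAlgebra.ι F ⁅x, y⁆) +
        f.1 (u * UniversalEnvelopingAlgebra.ι F y * UniversalEnvelopingAlgebra.ι F x)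
    rw [LieHom.map_lie, LieRing.of_associative_ring_bracket, mul_sub, map_sub, mul_assoc,
      mul_assoc, sub_add_cancel]

instance : LieModule F (vf F n T) (costandard F n T L) where
  smul_lie c x f := by
    apply Subtype.ext; apply LinearMap.ext; intro u
    change f.1 (u * UniversalEnvelopingAlgebra.ι F (c • x)) =
      c • f.1 (u * UniversalEnvelopingAlgebra.ι F x)
    rw [map_smul, mul_smul_comm, map_smul]
  lie_smul c x f := rfl

/-! ### The prolonged module -/

/-- The finite set of exponents that occur in the Jacobian matrix of a vector field. -/
def jacSupport (D : Der F n) : Finset (Fin n →₀ ℕ) :=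
  Finset.univ.biUnion fun i => Finset.univ.biUnion fun j => (pderiv j (D (X i))).support

/-- The action of `D = ∑ f_i ∂_i` on `P_n ⊗ L`:
`g ⊗ v ↦ D(g) ⊗ v + ∑_β x^β g ⊗ ξ(D_β) v`, where `ξ` is the representation of `g_[0]` on `L` and
`D_β = ∑_{i,j} c_{β,i,j} x_j ∂_i` with `∂_j(f_i) = ∑_β c_{β,i,j} x^β`. -/
def prolong (D : vf F n T) : Module.End F (Poly F n ⊗[F] L) :=
  LinearMap.rTensor L (D.1 : Poly F n →ₗ[F] Poly F n) +
    ∑ β ∈ jacSupport D.1, TensorProduct.map (LinearMap.mulLeft F (monomial β (1 : F)))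
      (LieModule.toEnd F (gradeZero F n T) L (lin T β D))

end Modules

/-! ### Explicit formulas for the prolonged action -/

theorem X_smul_pderiv_mem (i j : Fin n) :
    (X i : Poly F n) • (pderiv j : Der F n) ∈ derGrade F n 0 := by
  intro a m h
  rw [Derivation.smul_apply, pderiv_X, smul_eq_mul] at h
  by_cases h1 : j = a
  · subst h1
    rw [Pi.single_eq_same, mul_one, coeff_X] at h
    have : Finsupp.single i 1 = m := by by_contra h2; simp [h2] at h
    rw [← this]
    simp
  · rw [Pi.single_eq_of_ne (Ne.symm h1), mul_zero] at h
    simp at h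

variable (F) in
/-- `x_j ∂_i` in `W(n)_[0]`. -/
def linW (j i : Fin n) : gradeZero F n .W :=
  ⟨⟨(X j : Poly F n) • pderiv i, mem_W _⟩, mem_gradeZero (X_smul_pderiv_mem j i)⟩

theorem X_smul_pderiv_mem_S (j k : Fin n) (h : j ≠ k) :
    (X j : Poly F n) • (pderiv k : Der F n) ∈ vf F n .S := by
  rw [mem_S]
  unfold divergence
  refine Finset.sum_eq_zero fun i _ => ?_
  rw [Derivation.smul_apply, pderiv_X]
  by_cases h1 : k = i
  · subst h1; simp [pderiv_X, h]
  · simp [h1]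

theorem divergence_smul_pderiv (f : Poly F n) (k : Fin n) :
    divergence F n (f • pderiv k) = pderiv k f := by
  unfold divergence
  rw [Finset.sum_eq_single k]
  · simp
  · intro b _ hb
    simp [pderiv_X, Pi.single_eq_of_ne hb]
  · simp

theorem divergence_sub (D E : Der F n) :
    divergence F n (D - E) = divergence F n D - divergence F n E := by
  simp [divergence, Finset.sum_sub_distrib]

variable (F) in
/-- `x_j ∂_k` in `S(n)_[0]`, for `j ≠ k`. -/
def linS (j k : Fin n) (h : j ≠ k) : gradeZero F n .S :=
  ⟨⟨(X j : Poly F n) • pderiv k, X_smul_pderiv_mem_S j k h⟩, mem_gradeZero (X_smul_pderiv_mem j k)⟩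

variable (F) in
/-- `x_k ∂_k - x_l ∂_l` in `S(n)_[0]`. -/
def torusS (k l : Fin n) : gradeZero F n .S :=
  ⟨⟨(X k : Poly F n) • pderiv k - (X l : Poly F n) • pderiv l, by
    rw [mem_S, divergence_sub, divergence_smul_pderiv, divergence_smul_pderiv]
    simp⟩,
    mem_gradeZero (Submodule.sub_mem (derGrade F n 0) (X_smul_pderiv_mem k k)
      (X_smul_pderiv_mem l l))⟩

/-- `D_{kl}(f) = ∂_l(f) ∂_k - ∂_k(f) ∂_l` in `S(n)`. -/
def vfS (k l : Fin n) (f : Poly F n) : vf F n .S :=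
  ⟨pderiv l f • pderiv k - pderiv k f • pderiv l, by
    rw [mem_S, divergence_sub, divergence_smul_pderiv, divergence_smul_pderiv,
      pderiv_comm', sub_self]⟩

theorem partner_val (hn : Even n) (i : Fin n) :
    (partner i).val = if IsFirst i then i.val + n / 2 else i.val - n / 2 := by
  obtain ⟨r, hr⟩ := hn
  have hi := i.2
  by_cases h : i.val + n / 2 < n
  · rw [partner, dif_pos h, if_pos (show IsFirst i by unfold IsFirst; omega)]
  · rw [partner, dif_neg h, if_neg (show ¬ IsFirst i by unfold IsFirst; omega)]

theorem isFirst_partner (hn : Even n) (i : Fin n) : IsFirst (partner i) ↔ ¬ IsFirst i := by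
  have h := partner_val hn i
  obtain ⟨r, hr⟩ := hn
  have hi := i.2
  by_cases h1 : IsFirst i
  · rw [if_pos h1] at h
    unfold IsFirst at *
    omega
  · rw [if_neg h1] at h
    unfold IsFirst at *
    omega

theorem partner_partner (hn : Even n) (i : Fin n) : partner (partner i) = i := by
  apply Fin.ext
  have h1 := partner_val hn i
  have h2 := partner_val hn (partner i)
  have h3 := isFirst_partner hn i
  by_cases h : IsFirst i
  · rw [if_pos h] at h1
    rw [if_neg (by simp [h3, h])] at h2
    omega
  · rw [if_neg h] at h1
    rw [if_pos (by simp [h3, h])] at h2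
    unfold IsFirst at h
    omega

theorem sgn_partner (hn : Even n) (i : Fin n) : sgn F (partner i) = -sgn F i := by
  unfold sgn
  by_cases h : IsFirst i <;> simp [isFirst_partner hn, h]

theorem sgn_mul_sgn (i : Fin n) : sgn F i * sgn F i = 1 := by
  unfold sgn; split_ifs <;> simp

/-- `D_H(f) = ∑_i σ(i) ∂_i(f) ∂_{i'}`. -/
def derH (f : Poly F n) : Der F n := ∑ i, (sgn F i • pderiv i f) • pderiv (partner i)

theorem derH_X (hn : Even n) (f : Poly F n) (a : Fin n) :
    derH f (X a) = -(sgn F a • pderiv (partner a) f) := by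
  unfold derH
  rw [der_sum_apply, Finset.sum_eq_single (partner a)]
  · rw [partner_partner hn, sgn_partner hn]
    simp
  · intro b _ hb
    have : a ≠ partner b := fun h => hb (by rw [h, partner_partner hn])
    rw [Derivation.smul_apply, pderiv_X, Pi.single_eq_of_ne this, smul_zero]
  · simp

theorem derH_mem (hn : Even n) (f : Poly F n) : derH f ∈ vf F n .H := by
  rw [mem_H, lieDeriv_eq_zero_iff]
  intro j k
  have e : ∀ i : Fin n, sgn F i • (pderiv j (derH f (X i)) * pderiv k (X (partner i)) +
        pderiv j (X i) * pderiv k (derH f (X (partner i)))) =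
      (if i = partner k then -pderiv j (pderiv k f) else 0) +
        (if i = j then pderiv j (pderiv k f) else 0) := by
    intro i
    rw [derH_X hn, derH_X hn, partner_partner hn, sgn_partner hn, pderiv_X, pderiv_X, smul_add]
    congr 1
    · by_cases h : i = partner k
      · subst h
        rw [if_pos rfl, partner_partner hn, Pi.single_eq_same, mul_one, map_neg,
          Derivation.map_smul, smul_neg, smul_smul, sgn_mul_sgn, one_smul]
      · have : partner i ≠ k := fun h' => h (by rw [← h', partner_partner hn])
        rw [if_neg h, Pi.single_eq_of_ne this, mul_zero, smul_zero]
    · by_cases h : i = j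
      · subst h
        rw [if_pos rfl, Pi.single_eq_same, one_mul, neg_smul, neg_neg, Derivation.map_smul,
          smul_smul, sgn_mul_sgn, one_smul, pderiv_comm']
      · rw [if_neg h, Pi.single_eq_of_ne h, zero_mul, smul_zero]
  rw [Finset.sum_congr rfl fun i _ => e i, Finset.sum_add_distrib, Finset.sum_ite_eq',
    Finset.sum_ite_eq']
  simp

theorem derH_X_mul_X (j k : Fin n) : derH (X j * X k : Poly F n) =
    (sgn F j • X k : Poly F n) • pderiv (partner j) +
      (sgn F k • X j : Poly F n) • pderiv (partner k) := by
  unfold derH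
  have e : ∀ i : Fin n, (sgn F i • pderiv i (X j * X k : Poly F n)) •
      (pderiv (partner i) : Der F n) =
      (if i = j then (sgn F i • X k : Poly F n) • (pderiv (partner i) : Der F n) else 0) +
      (if i = k then (sgn F i • X j : Poly F n) • (pderiv (partner i) : Der F n) else 0) := by
    intro i
    rw [pderiv_mul, pderiv_X, pderiv_X, smul_add, add_smul]
    congr 1
    · by_cases h : i = j
      · subst h; simp
      · rw [if_neg h, Pi.single_eq_of_ne (Ne.symm h), zero_mul, smul_zero, zero_smul]
    · by_cases h : i = k
      · subst h; simp
      · rw [if_neg h, Pi.single_eq_of_ne (Ne.symm h), mul_zero, smul_zero, zero_smul]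
  rw [Finset.sum_congr rfl fun i _ => e i, Finset.sum_add_distrib, Finset.sum_ite_eq',
    Finset.sum_ite_eq']
  simp

theorem same_mem_H (hn : Even n) (j k : Fin n) (h : IsFirst j ↔ IsFirst k) :
    (X k : Poly F n) • (pderiv (partner j) : Der F n) +
      (X j : Poly F n) • pderiv (partner k) ∈ vf F n .H := by
  have hs : sgn F k = sgn F j := by unfold sgn; simp [h]
  have := (vf F n .H).smul_mem (sgn F j) (derH_mem hn (X j * X k : Poly F n))
  rwa [derH_X_mul_X, hs, smul_add, smul_assoc, smul_assoc, smul_smul, smul_smul, sgn_mul_sgn,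
    one_smul, one_smul] at this

theorem opp_mem_H (hn : Even n) (j k : Fin n) (hj : ¬ IsFirst j) (hk : IsFirst k) :
    (X k : Poly F n) • (pderiv (partner j) : Der F n) -
      (X j : Poly F n) • pderiv (partner k) ∈ vf F n .H := by
  have := (vf F n .H).neg_mem (derH_mem hn (X j * X k : Poly F n))
  have h1 : sgn F j = -1 := by unfold sgn; simp [hj]
  have h2 : sgn F k = 1 := by unfold sgn; simp [hk]
  rw [derH_X_mul_X, h1, h2] at this
  have e : (X k : Poly F n) • (pderiv (partner j) : Der F n) -
      (X j : Poly F n) • pderiv (partner k) = -(((-1 : F) • X k : Poly F n) • pderiv (partner j) +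
        ((1 : F) • X j : Poly F n) • pderiv (partner k)) := by
    have e1 : ((-1 : F) • X k : Poly F n) = -X k := by rw [neg_smul, one_smul]
    rw [e1, one_smul]
    refine Derivation.ext fun p => ?_
    simp only [Derivation.sub_apply, Derivation.neg_apply, Derivation.add_apply,
      Derivation.smul_apply, smul_eq_mul]
    ring
  rw [e]
  exact this

theorem diag_mem_H [CharZero F] (hn : Even n) (j : Fin n) :
    (X j : Poly F n) • (pderiv (partner j) : Der F n) ∈ vf F n .H := by
  have := (vf F n .H).smul_mem (2⁻¹ : F) (same_mem_H (F := F) hn j j Iff.rfl)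
  rwa [← two_smul F, smul_smul, inv_mul_cancel₀ two_ne_zero, one_smul] at this

variable (F) in
/-- `x_j ∂_{j'}` in `H(n)_[0]`. -/
def diagH [CharZero F] (hn : Even n) (j : Fin n) : gradeZero F n .H :=
  ⟨⟨(X j : Poly F n) • pderiv (partner j), diag_mem_H hn j⟩, mem_gradeZero (X_smul_pderiv_mem j _)⟩

variable (F) in
/-- `x_k ∂_{j'} + x_j ∂_{k'}` in `H(n)_[0]`, for `j` and `k` in the same half of the indices. -/
def sameH (hn : Even n) (j k : Fin n) (h : IsFirst j ↔ IsFirst k) : gradeZero F n .H :=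
  ⟨⟨(X k : Poly F n) • pderiv (partner j) + (X j : Poly F n) • pderiv (partner k),
    same_mem_H hn j k h⟩,
    mem_gradeZero (Submodule.add_mem (derGrade F n 0) (X_smul_pderiv_mem k _)
      (X_smul_pderiv_mem j _))⟩

variable (F) in
/-- `x_k ∂_{j'} - x_j ∂_{k'}` in `H(n)_[0]`, for `k` in the first half of the indices and `j` in
the second half. -/
def oppH (hn : Even n) (j k : Fin n) (hj : ¬ IsFirst j) (hk : IsFirst k) : gradeZero F n .H :=
  ⟨⟨(X k : Poly F n) • pderiv (partner j) - (X j : Poly F n) • pderiv (partner k),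
    opp_mem_H hn j k hj hk⟩,
    mem_gradeZero (Submodule.sub_mem (derGrade F n 0) (X_smul_pderiv_mem k _)
      (X_smul_pderiv_mem j _))⟩

/-- `c x^{α - ε_j - ε_k}` (used only with a coefficient `c` that vanishes if `α - ε_j - ε_k` has a
negative entry). -/
def xSub (α : Fin n →₀ ℕ) (j k : Fin n) (c : F) : Poly F n :=
  monomial (α - Finsupp.single j 1 - Finsupp.single k 1) c

variable (F n) in
/-- The explicit formulas for an action of `g` on `P_n ⊗ L`: on `∑ f_i ∂_i` for `W(n)`, on the
elements `D_{kl}(x^α)`, `k < l`, for `S(n)`, and on the elements `D_H(x^α)` for `H(n)`. -/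
def HasExplicitFormula [CharZero F] : (T : CartanType) → (L : Type*) → [AddCommGroup L] →
    [Module F L] → [LieRingModule (gradeZero F n T) L] →
    (vf F n T → Module.End F (Poly F n ⊗[F] L)) → Prop
  | .W, L, _, _, _, ρ => ∀ (f : Fin n → Poly F n) (g : Poly F n) (v : L),
      ρ ⟨∑ i, f i • pderiv i, mem_W _⟩ (g ⊗ₜ[F] v) =
        ∑ i, (f i * pderiv i g) ⊗ₜ[F] v +
        ∑ i, ∑ j, (pderiv j (f i) * g) ⊗ₜ[F] ⁅linW F j i, v⁆
  | .S, L, _, _, _, ρ => ∀ (k l : Fin n) (_ : k < l) (α : Fin n →₀ ℕ) (g : Poly F n) (v : L),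
      ρ (vfS k l (monomial α 1)) (g ⊗ₜ[F] v) =
        ((vfS k l (monomial α (1 : F))).1 g) ⊗ₜ[F] v +
        (xSub α k l ((α k : F) * α l) * g) ⊗ₜ[F] ⁅torusS F k l, v⁆ +
        ∑ j : {j : Fin n // j ≠ k},
          (xSub α j l ((α l : F) * ((α j : F) - if (j : Fin n) = l then 1 else 0)) * g) ⊗ₜ[F]
            ⁅linS F j k j.2, v⁆ -
        ∑ j : {j : Fin n // j ≠ l},
          (xSub α j k ((α k : F) * ((α j : F) - if (j : Fin n) = k then 1 else 0)) * g) ⊗ₜ[F]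
            ⁅linS F j l j.2, v⁆
  | .H, L, _, _, _, ρ => ∀ (hn : Even n) (α : Fin n →₀ ℕ) (g : Poly F n) (v : L),
      ρ ⟨derH (monomial α 1), derH_mem hn _⟩ (g ⊗ₜ[F] v) =
        (derH (monomial α (1 : F)) g) ⊗ₜ[F] v +
        ∑ j, (xSub α j j (sgn F j * (α j : F) * ((α j : F) - 1)) * g) ⊗ₜ[F] ⁅diagH F hn j, v⁆ +
        ∑ p : {p : Fin n × Fin n // p.1 < p.2 ∧ (IsFirst p.1 ∧ IsFirst p.2)},
          (xSub α p.1.1 p.1.2 ((α p.1.1 : F) * α p.1.2) * g) ⊗ₜ[F]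
            ⁅sameH F hn p.1.1 p.1.2 (iff_of_true p.2.2.1 p.2.2.2), v⁆ -
        ∑ p : {p : Fin n × Fin n // ¬ IsFirst p.1 ∧ IsFirst p.2},
          (xSub α p.1.1 p.1.2 ((α p.1.1 : F) * α p.1.2) * g) ⊗ₜ[F]
            ⁅oppH F hn p.1.1 p.1.2 p.2.1 p.2.2, v⁆ -
        ∑ p : {p : Fin n × Fin n // p.1 < p.2 ∧ (¬ IsFirst p.1 ∧ ¬ IsFirst p.2)},
          (xSub α p.1.1 p.1.2 ((α p.1.1 : F) * α p.1.2) * g) ⊗ₜ[F]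
            ⁅sameH F hn p.1.1 p.1.2 (iff_of_false p.2.2.1 p.2.2.2), v⁆

/-! ### The monomials in the partial derivatives -/

theorem pderiv_mem_vf (T : CartanType) (i : Fin n) : (pderiv i : Der F n) ∈ vf F n T := by
  refine mem_vf_of_pderiv T 0 _ 0 (fun a b => ?_) (zero_mem _)
  rw [pderiv_X]
  by_cases h : i = a <;> simp [h]

variable (F n) in
/-- The element `∂_1^{a_1} ⋯ ∂_n^{a_n}` of `U(g)`. -/
def uPartial (T : CartanType) (a : Fin n → ℕ) : U F n T :=
  (List.ofFn fun i =>
    UniversalEnvelopingAlgebra.ι F (⟨pderiv i, pderiv_mem_vf T i⟩ : vf F n T) ^ a i).prod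

/-- The polynomial `∂_1^{a_1} ⋯ ∂_n^{a_n}(f)`. -/
def iterPartial (a : Fin n → ℕ) (f : Poly F n) : Poly F n :=
  (List.ofFn fun i => (((pderiv i : Der F n) : Poly F n →ₗ[F] Poly F n) :
    Module.End F (Poly F n)) ^ a i).prod f

end Basic

end

end CartanVF

/-! For a vector field `D`, collect the linear fields `D_β` into one element `jac T D = ∑ x^β ⊗ D_β`
of the current Lie algebra `P_n ⊗ g_[0]`; it is the Jacobian matrix of `D`. This current algebra
acts on `P_n ⊗ L` (`act`), derivations of `P_n` act on the first factor, and `ρ(D)` is the sum of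
the action of `D` and that of `jac T D`.

Why `ρ` is a representation: by the chain rule the Jacobian is a crossed homomorphism, `jac [D,E] =
D(jac E) - E(jac D) + [jac D, jac E]` (`jac_lie`). So `D ↦ (D, jac D)` is a homomorphism into the
semidirect product of the derivations with the current algebra, and that product acts on `P_n ⊗ L`
(`act_act`, `rTensor_act`). Since an element of `P_n ⊗ g_[0]` is determined by its matrix entries
(`entry_ext`), identities for `jac` are checked entry by entry through `jac_eq_iff`. The explicit
formulas follow in the same way, by exhibiting elements of `P_n ⊗ g_[0]` with the right Jacobian
entries (`jac_W`, `jac_S`, `jac_H`).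

The isomorphism sends `m` to the functional `u ↦ (u m)(0)` (`toHom`). It intertwines the actions
because right multiplication of `u` by `x` amounts to acting by `x` on `m`. It takes values in
`U(g_0)`-linear maps because, for fields vanishing at the origin, evaluation at `0` turns `ρ` into
the action of the linear part on `L` (`evalZero_prolong`). The field `∂_i` has zero Jacobian, hence
acts by plain differentiation, and the value at `∂^a` is a nonzero multiple of the `x^a` coefficient
of `m` (`exists_toHom_uPartial`); this gives injectivity. For surjectivity, `U(g)` is generated by
the `∂^a` over `U(g_0)` (`span_uIncl_mul_uPartial`), so a functional is determined by its values
there. A homogeneous one is nonzero at only finitely many `∂^a`, and a polynomial with the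
prescribed coefficients realises these values. -/

namespace CartanVF

noncomputable section

/-! ### The current algebra `P_n ⊗ g_[0]` and its action on `P_n ⊗ L`. -/

section Current

variable (F : Type*) [Field F] (n : ℕ) (T : CartanType) (L : Type*) [AddCommGroup L] [Module F L]
  [LieRingModule (gradeZero F n T) L] [LieModule F (gradeZero F n T) L]

/-- The action of the current algebra `P_n ⊗ g_[0]` on `P_n ⊗ L`. For `L = g_[0]` it is the
bracket of the current algebra. -/
def act : Poly F n ⊗[F] gradeZero F n T →ₗ[F] Module.End F (Poly F n ⊗[F] L) :=
  TensorProduct.homTensorHomMap (RingHom.id F) (Poly F n) L (Poly F n) L ∘ₗ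
    TensorProduct.map (LinearMap.mul F (Poly F n))
      (LieModule.toEnd F (gradeZero F n T) L : gradeZero F n T →ₗ[F] Module.End F L)

variable {F n T L}

@[simp]
theorem act_tmul (p q : Poly F n) (x : gradeZero F n T) (v : L) :
    act F n T L (p ⊗ₜ x) (q ⊗ₜ v) = (p * q) ⊗ₜ ⁅x, v⁆ := rfl

/-- Since `P_n` is commutative, the commutator of the actions of `p ⊗ x` and `q ⊗ y` is the action
of `pq ⊗ [x, y]`. -/
theorem act_act (t s : Poly F n ⊗[F] gradeZero F n T) (m : Poly F n ⊗[F] L) :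
    act F n T L (act F n T _ t s) m =
      act F n T L t (act F n T L s m) - act F n T L s (act F n T L t m) := by
  induction t with
  | zero => simp
  | add a b ha hb => simp only [LinearMap.add_apply, map_add, ha, hb]; abel
  | tmul p x =>
    induction s with
    | zero => simp
    | add a b ha hb => simp only [LinearMap.add_apply, map_add, ha, hb]; abel
    | tmul q y =>
      induction m with
      | zero => simp
      | add a b ha hb => simp only [map_add, ha, hb]; abel
      | tmul r v =>
        simp only [act_tmul, lie_lie, TensorProduct.tmul_sub]
        rw [mul_assoc, mul_left_comm q p r]

end Current

/-! ### The Jacobian as a crossed homomorphism. -/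

section Jacobian

variable {F : Type*} [Field F] {n : ℕ}

/-- The chain rule: differentiating `D(E p) = ∑ D(x_k) ∂_k(E p)`, the second-order terms reassemble
to `D(∂_j(E p))`. What remains is a product of Jacobian entries when `p = x_i`. -/
theorem pderiv_der_der (D E : Der F n) (p : Poly F n) (j : Fin n) :
    pderiv j (D (E p)) - D (pderiv j (E p)) =
      ∑ k, pderiv j (D (X k)) * pderiv k (E p) := by
  rw [der_apply D (E p), der_apply D (pderiv j (E p)), map_sum, ← Finset.sum_sub_distrib]
  refine Finset.sum_congr rfl fun k _ => ?_
  rw [pderiv_mul, pderiv_comm' j k, add_sub_cancel_right]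

theorem eq_zero_of_pderiv_eq_zero [CharZero F] {p : Poly F n} (h0 : coeff 0 p = 0)
    (h : ∀ j, pderiv j p = 0) : p = 0 := by
  ext m
  rw [coeff_zero]
  by_cases hm : m = 0
  · rw [hm, h0]
  · obtain ⟨j, hj⟩ := Finsupp.ne_iff.mp hm
    have h1 := congrArg (coeff (m - Finsupp.single j 1)) (h j)
    have h2 : m - Finsupp.single j 1 + Finsupp.single j 1 = m :=
      tsub_add_cancel_of_le (Finsupp.single_le_iff.mpr (Nat.one_le_iff_ne_zero.mpr hj))
    rw [coeff_pderiv, h2, coeff_zero] at h1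
    exact (mul_eq_zero.mp h1).resolve_right (Nat.cast_add_one_ne_zero _)

theorem pderiv_gradeZero {T : CartanType} (x : gradeZero F n T) (i j : Fin n) :
    pderiv j (x.1.1 (X i)) = C (coeff 0 (pderiv j (x.1.1 (X i)))) := by
  ext m
  rw [coeff_C]
  split_ifs with h
  · rw [h]
  · by_contra h1
    rw [coeff_pderiv] at h1
    have h2 := x.2 i _ (left_ne_zero_of_mul h1)
    simp only [map_add, Finsupp.degree_single, Nat.cast_add, Nat.cast_one] at h2
    have h3 : m.degree = 0 := by omega
    exact h ((Finsupp.degree_eq_zero_iff m).mp h3).symm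

/-- Fields in `g_[0]` have linear components without constant term, so their constant Jacobian
matrix determines them. -/
theorem gradeZero_ext [CharZero F] {T : CartanType} {x y : gradeZero F n T}
    (h : ∀ i j, coeff 0 (pderiv j (x.1.1 (X i))) = coeff 0 (pderiv j (y.1.1 (X i)))) : x = y := by
  apply Subtype.ext; apply Subtype.ext; apply derivation_ext
  intro i
  rw [← sub_eq_zero]
  apply eq_zero_of_pderiv_eq_zero
  · rw [coeff_sub]
    have h0 : ∀ z : gradeZero F n T, coeff 0 (z.1.1 (X i)) = 0 := by
      intro z
      by_contra hz
      have := z.2 i 0 hz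
      simp at this
    rw [h0, h0, sub_zero]
  · intro j
    rw [map_sub, pderiv_gradeZero, pderiv_gradeZero y, h, sub_self]

variable (F) in
/-- The entry `∂_j(t(x_i))` of the Jacobian matrix of an element `t` of `P_n ⊗ g_[0]`, where
`p ⊗ x` has the entry `p ∂_j(x(x_i))`. -/
def entry (T : CartanType) (i j : Fin n) : Poly F n ⊗[F] gradeZero F n T →ₗ[F] Poly F n :=
  LinearMap.mul' F (Poly F n) ∘ₗ LinearMap.lTensor (Poly F n)
    { toFun := fun x => pderiv j (x.1.1 (X i))
      map_add' := fun x y => map_add (pderiv j) (x.1.1 (X i)) (y.1.1 (X i))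
      map_smul' := fun c x => (pderiv j).map_smul c (x.1.1 (X i)) }

variable {T : CartanType}

@[simp]
theorem entry_tmul (i j : Fin n) (p : Poly F n) (x : gradeZero F n T) :
    entry F T i j (p ⊗ₜ x) = p * pderiv j (x.1.1 (X i)) := rfl

/-- The bracket of the current algebra becomes a matrix commutator, in reversed order: composing
linear fields as operators multiplies their Jacobians the other way round. -/
theorem entry_act (t s : Poly F n ⊗[F] gradeZero F n T) (i j : Fin n) :
    entry F T i j (act F n T _ t s) = ∑ k, (entry F T k j t * entry F T i k s -
      entry F T k j s * entry F T i k t) := by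
  induction t with
  | zero => simp
  | add a b ha hb =>
    rw [map_add, LinearMap.add_apply, map_add, ha, hb, ← Finset.sum_add_distrib]
    refine Finset.sum_congr rfl fun k _ => ?_
    rw [map_add, map_add]; ring
  | tmul p x =>
    induction s with
    | zero => simp
    | add a b ha hb =>
      rw [map_add, map_add, ha, hb, ← Finset.sum_add_distrib]
      refine Finset.sum_congr rfl fun k _ => ?_
      rw [map_add, map_add]; ring
    | tmul q y =>
      rw [act_tmul, entry_tmul]
      change p * q * pderiv j (⁅x.1.1, y.1.1⁆ (X i)) = _
      -- In the chain rule the term `z(∂_j(w x_i))` vanishes, because `w` is linear and `∂_j(w x_i)`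
      -- is a constant.
      have key : ∀ z w : gradeZero F n T, pderiv j (z.1.1 (w.1.1 (X i))) =
          ∑ k, pderiv j (z.1.1 (X k)) * pderiv k (w.1.1 (X i)) := by
        intro z w
        rw [← pderiv_der_der, pderiv_gradeZero w, ← algebraMap_eq, Derivation.map_algebraMap,
          sub_zero]
      rw [Derivation.commutator_apply, map_sub, key, key, ← Finset.sum_sub_distrib, Finset.mul_sum]
      refine Finset.sum_congr rfl fun k _ => ?_
      simp only [entry_tmul]
      ring

/-- The Jacobian entries of elements of `g_[0]` are constants, so `D` only differentiates the
polynomial factor. -/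
theorem entry_rTensor (D : Der F n) (t : Poly F n ⊗[F] gradeZero F n T) (i j : Fin n) :
    entry F T i j (LinearMap.rTensor _ (D : Poly F n →ₗ[F] Poly F n) t) =
      D (entry F T i j t) := by
  induction t with
  | zero => simp
  | add a b ha hb => rw [map_add, map_add, ha, hb, map_add, map_add]
  | tmul p x =>
    rw [LinearMap.rTensor_tmul, entry_tmul, entry_tmul, Derivation.leibniz, pderiv_gradeZero x,
      ← algebraMap_eq, Derivation.map_algebraMap, smul_zero, zero_add, smul_eq_mul, mul_comm]
    rfl

/-- Expand `t` in monomials as `∑ x^γ ⊗ t_γ`. The Jacobian of `t_γ` consists of the `x^γ`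
coefficients of the entries of `t`, so the claim reduces to `gradeZero_ext` for each `γ`. -/
theorem entry_ext [CharZero F] {t s : Poly F n ⊗[F] gradeZero F n T}
    (h : ∀ i j, entry F T i j t = entry F T i j s) : t = s := by
  let e := TensorProduct.equivFinsuppOfBasisLeft (N := gradeZero F n T) (basisMonomials (Fin n) F)
  have key : ∀ (t : Poly F n ⊗[F] gradeZero F n T) (γ : Fin n →₀ ℕ) (i j : Fin n),
      coeff 0 (pderiv j ((e t γ).1.1 (X i))) = coeff γ (entry F T i j t) := by
    intro t γ i j
    induction t with
    | zero => simp
    | add a b ha hb =>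
      have h1 : (e (a + b) γ).1.1 (X i) = (e a γ).1.1 (X i) + (e b γ).1.1 (X i) := by
        rw [map_add]; rfl
      rw [h1, map_add, map_add, coeff_add, coeff_add, ha, hb]
    | tmul p x =>
      have h1 : e (p ⊗ₜ x) γ = coeff γ p • x :=
        TensorProduct.equivFinsuppOfBasisLeft_apply_tmul_apply _ _ _ _
      have h2 : (coeff γ p • x).1.1 (X i) = coeff γ p • x.1.1 (X i) := rfl
      rw [h1, h2, entry_tmul, Derivation.map_smul, coeff_smul, pderiv_gradeZero, mul_comm,
        coeff_C_mul, coeff_C, if_pos rfl, smul_eq_mul, mul_comm]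
  apply e.injective
  ext1 γ
  apply gradeZero_ext
  intro i j
  rw [key, key, h]

variable (T) in
/-- The Jacobian of a vector field, as an element of `P_n ⊗ g_[0]`. -/
def jac (D : vf F n T) : Poly F n ⊗[F] gradeZero F n T :=
  ∑ β ∈ jacSupport D.1, monomial β 1 ⊗ₜ lin T β D

theorem entry_jac (D : vf F n T) (i j : Fin n) :
    entry F T i j (jac T D) = pderiv j (D.1 (X i)) := by
  have h : ∀ β, pderiv j ((lin T β D).1.1 (X i)) = C (coeff β (pderiv j (D.1 (X i)))) :=
    fun β => pderiv_derLin β D.1 i j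
  unfold jac
  rw [map_sum]
  simp only [entry_tmul, h]
  have h1 : (pderiv j (D.1 (X i))).support ⊆ jacSupport D.1 := by
    intro β hβ
    simp only [jacSupport, Finset.mem_biUnion, Finset.mem_univ, true_and]
    exact ⟨i, j, hβ⟩
  conv_rhs => rw [as_sum (pderiv j (D.1 (X i)))]
  -- `jacSupport` is the union of the supports of all entries; exponents outside the support of this
  -- particular entry contribute zero.
  rw [Finset.sum_subset h1]
  · refine Finset.sum_congr rfl fun β _ => ?_
    rw [mul_comm, C_mul_monomial, mul_one]
  · intro β _ hβ
    rw [notMem_support_iff.mp hβ, map_zero]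

variable [CharZero F]

/-- This characterisation avoids the sum over `jacSupport D`, whose index set varies with `D`. -/
theorem jac_eq_iff {D : vf F n T} {t : Poly F n ⊗[F] gradeZero F n T} :
    jac T D = t ↔ ∀ i j, entry F T i j t = pderiv j (D.1 (X i)) := by
  constructor
  · rintro rfl i j
    exact entry_jac D i j
  · intro h
    refine entry_ext fun i j => ?_
    rw [entry_jac, h]

theorem jac_add (D E : vf F n T) : jac T (D + E) = jac T D + jac T E := by
  rw [jac_eq_iff]
  intro i j
  rw [map_add, entry_jac, entry_jac, ← map_add]
  rfl

theorem jac_smul (c : F) (D : vf F n T) : jac T (c • D) = c • jac T D := by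
  rw [jac_eq_iff]
  intro i j
  rw [map_smul, entry_jac, ← Derivation.map_smul]
  rfl

theorem jac_lie (D E : vf F n T) : jac T ⁅D, E⁆ =
    LinearMap.rTensor _ (D.1 : Poly F n →ₗ[F] Poly F n) (jac T E) -
      LinearMap.rTensor _ (E.1 : Poly F n →ₗ[F] Poly F n) (jac T D) +
        act F n T _ (jac T D) (jac T E) := by
  rw [jac_eq_iff]
  intro i j
  rw [map_add, map_sub, entry_rTensor, entry_rTensor, entry_act]
  simp only [entry_jac]
  rw [Finset.sum_sub_distrib, ← pderiv_der_der, ← pderiv_der_der]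
  change _ = pderiv j (⁅D.1, E.1⁆ (X i))
  rw [Derivation.commutator_apply, map_sub]
  ring

end Jacobian

/-! ### The prolonged action is a representation. -/

section Representation

variable {F : Type*} [Field F] {n : ℕ} {T : CartanType} {L : Type*} [AddCommGroup L] [Module F L]
  [LieRingModule (gradeZero F n T) L] [LieModule F (gradeZero F n T) L]

/-- The Leibniz rule on `P_n`: derivations act compatibly on the current algebra and on its module,
as the semidirect product requires. -/
theorem rTensor_act (D : Der F n) (t : Poly F n ⊗[F] gradeZero F n T) (m : Poly F n ⊗[F] L) :
    LinearMap.rTensor L (D : Poly F n →ₗ[F] Poly F n) (act F n T L t m) =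
      act F n T L (LinearMap.rTensor _ (D : Poly F n →ₗ[F] Poly F n) t) m +
        act F n T L t (LinearMap.rTensor L (D : Poly F n →ₗ[F] Poly F n) m) := by
  induction t with
  | zero => simp
  | add a b ha hb => simp only [LinearMap.add_apply, map_add, ha, hb]; abel
  | tmul p x =>
    induction m with
    | zero => simp
    | add a b ha hb => simp only [map_add, ha, hb]; abel
    | tmul q v =>
      simp only [LinearMap.rTensor_tmul, act_tmul, ← TensorProduct.add_tmul]
      congr 1
      change D (p * q) = D p * q + p * D q
      rw [Derivation.leibniz, smul_eq_mul, smul_eq_mul]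
      ring

theorem prolong_apply (D : vf F n T) (m : Poly F n ⊗[F] L) :
    prolong T L D m =
      LinearMap.rTensor L (D.1 : Poly F n →ₗ[F] Poly F n) m + act F n T L (jac T D) m := by
  unfold prolong jac
  rw [LinearMap.add_apply, LinearMap.sum_apply, map_sum, LinearMap.sum_apply]
  rfl

theorem prolong_tmul (D : vf F n T) (g : Poly F n) (v : L) :
    prolong T L D (g ⊗ₜ v) = D.1 g ⊗ₜ v + act F n T L (jac T D) (g ⊗ₜ v) := by
  rw [prolong_apply, LinearMap.rTensor_tmul]
  rfl

variable (F n T L) in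
/-- The prolonged action of `g` on `P_n ⊗ L`, as a representation. -/
def prolongHom [CharZero F] : vf F n T →ₗ⁅F⁆ Module.End F (Poly F n ⊗[F] L) where
  toFun := prolong T L
  map_add' D E := by
    refine LinearMap.ext fun m => ?_
    rw [LinearMap.add_apply, prolong_apply, prolong_apply, prolong_apply, jac_add, map_add,
      LinearMap.add_apply]
    have : ((D + E).1 : Poly F n →ₗ[F] Poly F n) = D.1 + E.1 := rfl
    rw [this, LinearMap.rTensor_add, LinearMap.add_apply]
    abel
  map_smul' c D := by
    refine LinearMap.ext fun m => ?_
    rw [RingHom.id_apply, LinearMap.smul_apply, prolong_apply, prolong_apply, jac_smul]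
    have : ((c • D).1 : Poly F n →ₗ[F] Poly F n) = c • D.1 := rfl
    rw [this, map_smul, LinearMap.rTensor_smul, LinearMap.smul_apply, LinearMap.smul_apply,
      smul_add]
  map_lie' := by
    intro D E
    refine LinearMap.ext fun m => ?_
    have : ((⁅D, E⁆ : vf F n T).1 : Poly F n →ₗ[F] Poly F n) =
      (D.1 : Poly F n →ₗ[F] Poly F n) ∘ₗ (E.1 : Poly F n →ₗ[F] Poly F n) -
      (E.1 : Poly F n →ₗ[F] Poly F n) ∘ₗ (D.1 : Poly F n →ₗ[F] Poly F n) := by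
      refine LinearMap.ext fun p => ?_
      exact Derivation.commutator_apply p
    rw [LieRing.of_associative_ring_bracket, LinearMap.sub_apply, Module.End.mul_apply,
      Module.End.mul_apply]
    simp only [prolong_apply]
    -- The cross terms of the commutator are `D(jac E) - E(jac D)` by the Leibniz rule, and the
    -- current parts give `[jac D, jac E]`; together with the commutator on `P_n` these are the
    -- terms of `jac_lie`.
    rw [this, jac_lie, LinearMap.rTensor_sub, LinearMap.rTensor_comp, LinearMap.rTensor_comp]
    simp only [LinearMap.sub_apply, LinearMap.comp_apply, LinearMap.add_apply, map_add, map_sub,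
      rTensor_act, act_act]
    abel

end Representation

/-! ### The explicit formulas for `W(n)`, `S(n)` and `H(n)`. -/

section ExplicitFormulas

variable {F : Type*} [Field F] {n : ℕ}

theorem pderiv_pderiv_monomial (α : Fin n →₀ ℕ) (j l : Fin n) :
    pderiv j (pderiv l (monomial α (1 : F))) =
      xSub α j l ((α l : F) * ((α j : F) - if j = l then 1 else 0)) := by
  rw [pderiv_monomial, pderiv_monomial, xSub, tsub_right_comm, one_mul]
  congr 1
  by_cases h : j = l
  · subst h
    rw [if_pos rfl, Finsupp.tsub_apply, Finsupp.single_eq_same]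
    -- The truncated exponent `α j - 1` differs from `α j - 1` in `F` only if `α j = 0`, and then
    -- the other factor is zero.
    rcases α j with _ | m
    · simp
    · simp
  · rw [if_neg h, Finsupp.tsub_apply, Finsupp.single_eq_of_ne h, tsub_zero, sub_zero]

theorem xSub_of_ne (α : Fin n →₀ ℕ) {j k : Fin n} (h : j ≠ k) :
    xSub α j k ((α j : F) * α k) = pderiv j (pderiv k (monomial α (1 : F))) := by
  rw [pderiv_pderiv_monomial, if_neg h, sub_zero, mul_comm]

theorem xSub_self (α : Fin n →₀ ℕ) (j : Fin n) (c : F) :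
    xSub α j j (c * (α j : F) * ((α j : F) - 1)) =
      c • pderiv j (pderiv j (monomial α (1 : F))) := by
  rw [pderiv_pderiv_monomial, if_pos rfl, xSub, xSub, smul_monomial, smul_eq_mul, mul_assoc]

theorem pderiv_X_smul_pderiv (j k a b : Fin n) :
    pderiv b (((X j : Poly F n) • (pderiv k : Der F n)) (X a)) =
      if (k, j) = (a, b) then 1 else 0 := by
  rw [Derivation.smul_apply, pderiv_X, smul_eq_mul]
  by_cases h : k = a
  · subst h
    rw [Pi.single_eq_same, mul_one, pderiv_X, Pi.single_apply]
    simp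
  · rw [Pi.single_eq_of_ne (Ne.symm h), mul_zero, map_zero, if_neg (by simp [h])]

/-- Used to read off one matrix entry from the restricted index sums in the formulas for `S(n)` and
`H(n)`. -/
theorem sum_subtype_mul_ite {ι R : Type*} [DecidableEq ι] [CommSemiring R] (P : ι → Prop)
    [DecidablePred P] [Fintype {x // P x}] (c : ι → R) (a : ι) :
    ∑ x : {x // P x}, c x * (if (x : ι) = a then 1 else 0) = if P a then c a else 0 := by
  split_ifs with h
  · rw [Finset.sum_eq_single ⟨a, h⟩]
    · simp
    · intro b _ hb
      rw [if_neg fun h1 => hb (Subtype.ext h1), mul_zero]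
    · simp
  · refine Finset.sum_eq_zero fun x _ => ?_
    rw [if_neg fun h1 : (x : ι) = a => h (h1 ▸ x.2), mul_zero]

variable [CharZero F]

theorem jac_W (f : Fin n → Poly F n) :
    jac .W ⟨∑ i, f i • pderiv i, mem_W _⟩ = ∑ i, ∑ j, pderiv j (f i) ⊗ₜ linW F j i := by
  rw [jac_eq_iff]
  intro a b
  have h : ∀ i j, pderiv b ((linW F j i).1.1 (X a)) = if (i, j) = (a, b) then 1 else 0 :=
    fun i j => pderiv_X_smul_pderiv j i a b
  simp only [map_sum, entry_tmul, h, Prod.mk.injEq, mul_ite, mul_one, mul_zero, der_sum_apply,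
    Derivation.smul_apply, pderiv_X, Pi.single_apply, smul_eq_mul, ite_and]
  simp [← map_sum]

theorem jac_S (k l : Fin n) (α : Fin n →₀ ℕ) :
    jac .S (vfS k l (monomial α (1 : F))) =
      pderiv k (pderiv l (monomial α (1 : F))) ⊗ₜ torusS F k l +
      ∑ j : {j : Fin n // j ≠ k}, pderiv j.1 (pderiv l (monomial α (1 : F))) ⊗ₜ linS F j k j.2 -
      ∑ j : {j : Fin n // j ≠ l}, pderiv j.1 (pderiv k (monomial α (1 : F))) ⊗ₜ
        linS F j l j.2 := by
  rw [jac_eq_iff]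
  intro a b
  have h1 : pderiv b ((torusS F k l).1.1 (X a)) =
      (if (k, k) = (a, b) then 1 else 0) - if (l, l) = (a, b) then 1 else 0 := by
    rw [← pderiv_X_smul_pderiv, ← pderiv_X_smul_pderiv, ← map_sub]
    rfl
  have h2 : ∀ (m : Fin n) (j : {j : Fin n // j ≠ m}), pderiv b ((linS F j m j.2).1.1 (X a)) =
      (if m = a then 1 else 0) * if j.1 = b then 1 else 0 := by
    intro m j
    refine (pderiv_X_smul_pderiv _ _ _ _).trans ?_
    rw [ite_zero_mul_ite_zero, mul_one]
    simp only [Prod.mk.injEq]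
  have h3 : (vfS k l (monomial α (1 : F))).1 (X a) =
      (if k = a then pderiv l (monomial α (1 : F)) else 0) -
        if l = a then pderiv k (monomial α (1 : F)) else 0 := by
    simp [vfS, Derivation.sub_apply, pderiv_X, Pi.single_apply, eq_comm]
  have h4 : ∀ (m : Fin n) (p : Poly F n), ∑ j : {j : Fin n // j ≠ m}, pderiv j.1 p *
      ((if m = a then 1 else 0) * if j.1 = b then 1 else 0) =
      if m = a ∧ b ≠ m then pderiv b p else 0 := by
    intro m p
    simp only [← mul_assoc]
    rw [sum_subtype_mul_ite (fun j => j ≠ m) (fun j => pderiv j p * if m = a then 1 else 0)]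
    by_cases ha : m = a <;> by_cases hb : b = m <;> simp [ha, hb]
  rw [map_sub, map_add, map_sum, map_sum]
  simp only [entry_tmul, h1, h2, h3, h4, Prod.mk.injEq]
  rw [map_sub]
  -- Row `m` of the Jacobian splits into its off-diagonal part, given by the `linS` terms, and its
  -- diagonal entry. The diagonal entries for `k` and `l` are `±∂_k∂_l(x^α)`, which is the `torusS`
  -- term.
  have h5 : ∀ (m : Fin n) (p : Poly F n), pderiv b (if m = a then p else 0) =
      (if m = a ∧ b ≠ m then pderiv b p else 0) +
        pderiv m p * if m = a ∧ m = b then 1 else 0 := by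
    intro m p
    by_cases ha : m = a <;> by_cases hb : m = b
    · simp [ha, ← hb]
    · subst ha; simp [hb, Ne.symm hb]
    · simp [ha]
    · simp [ha]
  rw [h5 k, h5 l, pderiv_comm' l k]
  ring

theorem jac_H (hn : Even n) (α : Fin n →₀ ℕ) :
    jac .H ⟨derH (monomial α (1 : F)), derH_mem hn _⟩ =
      ∑ j, (sgn F j • pderiv j (pderiv j (monomial α (1 : F)))) ⊗ₜ diagH F hn j +
      ∑ p : {p : Fin n × Fin n // p.1 < p.2 ∧ (IsFirst p.1 ∧ IsFirst p.2)},
        pderiv p.1.1 (pderiv p.1.2 (monomial α (1 : F))) ⊗ₜ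
          sameH F hn p.1.1 p.1.2 (iff_of_true p.2.2.1 p.2.2.2) -
      ∑ p : {p : Fin n × Fin n // ¬ IsFirst p.1 ∧ IsFirst p.2},
        pderiv p.1.1 (pderiv p.1.2 (monomial α (1 : F))) ⊗ₜ
          oppH F hn p.1.1 p.1.2 p.2.1 p.2.2 -
      ∑ p : {p : Fin n × Fin n // p.1 < p.2 ∧ (¬ IsFirst p.1 ∧ ¬ IsFirst p.2)},
        pderiv p.1.1 (pderiv p.1.2 (monomial α (1 : F))) ⊗ₜ
          sameH F hn p.1.1 p.1.2 (iff_of_false p.2.2.1 p.2.2.2) := by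
  rw [jac_eq_iff]
  intro a b
  -- With rows indexed by partners, `x_k ∂_{j'}` has its single entry at `(j, k)`, and the Jacobian
  -- of `D_H(f)` is the Hessian `σ(a) ∂_a ∂_b f`. Its symmetry pairs the positions `(j, k)` and `(k,
  -- j)`.
  obtain ⟨a, rfl⟩ : ∃ c, partner c = a := ⟨partner a, partner_partner hn a⟩
  have hp : ∀ j k : Fin n, pderiv b (((X k : Poly F n) • (pderiv (partner j) : Der F n))
      (X (partner a))) = if (j, k) = (a, b) then 1 else 0 := by
    intro j k
    rw [pderiv_X_smul_pderiv]
    have : partner j = partner a ↔ j = a :=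
      ⟨fun h => by rw [← partner_partner hn j, h, partner_partner hn], fun h => h ▸ rfl⟩
    simp only [Prod.mk.injEq, this]
  have h1 : ∀ j, pderiv b ((diagH F hn j).1.1 (X (partner a))) =
      if (j, j) = (a, b) then 1 else 0 := fun j => hp j j
  have h2 : ∀ j k h, pderiv b ((sameH F hn j k h).1.1 (X (partner a))) =
      (if (j, k) = (a, b) then 1 else 0) + if (j, k) = (b, a) then 1 else 0 := by
    intro j k h
    have : ((j, k) = (b, a)) = ((k, j) = (a, b)) := by simp [and_comm]
    simp only [this]
    rw [← hp, ← hp, ← map_add]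
    rfl
  have h3 : ∀ j k hj hk, pderiv b ((oppH F hn j k hj hk).1.1 (X (partner a))) =
      (if (j, k) = (a, b) then 1 else 0) - if (j, k) = (b, a) then 1 else 0 := by
    intro j k hj hk
    have : ((j, k) = (b, a)) = ((k, j) = (a, b)) := by simp [and_comm]
    simp only [this]
    rw [← hp, ← hp, ← map_sub]
    rfl
  rw [map_sub, map_sub, map_add, map_sum, map_sum, map_sum, map_sum]
  change _ = pderiv b (derH (monomial α (1 : F)) (X (partner a)))
  rw [derH_X hn, partner_partner hn, sgn_partner hn, neg_smul, neg_neg, Derivation.map_smul]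
  simp only [entry_tmul, h1, h2, h3, Prod.mk.eta, mul_add, mul_sub, Finset.sum_add_distrib,
    Finset.sum_sub_distrib]
  have e := fun (P : Fin n × Fin n → Prop) [DecidablePred P] => sum_subtype_mul_ite P
    (fun p => pderiv p.1 (pderiv p.2 (monomial α (1 : F))))
  simp only [e fun p => p.1 < p.2 ∧ (IsFirst p.1 ∧ IsFirst p.2),
    e fun p => ¬ IsFirst p.1 ∧ IsFirst p.2,
    e fun p => p.1 < p.2 ∧ (¬ IsFirst p.1 ∧ ¬ IsFirst p.2)]
  rw [pderiv_comm' b a]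
  have h4 : ∑ j, (sgn F j • pderiv j (pderiv j (monomial α (1 : F)))) *
      (if (j, j) = (a, b) then 1 else 0) =
      if a = b then sgn F a • pderiv a (pderiv b (monomial α (1 : F))) else 0 := by
    simp only [Prod.mk.injEq, ite_and, mul_ite, mul_one, mul_zero]
    rw [Finset.sum_ite_eq']
    by_cases h : a = b <;> simp [h]
  rw [h4]
  have hs : IsFirst a → sgn F a = 1 := fun h => by simp [sgn, h]
  have hs' : ¬ IsFirst a → sgn F a = -1 := fun h => by simp [sgn, h]
  -- At each position exactly one of the four sums contributes, according to whether `a = b` and to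
  -- the halves containing `a` and `b`; the sign is `σ(a)`.
  rcases lt_trichotomy a b with h | h | h
  · by_cases ha : IsFirst a <;> by_cases hb : IsFirst b <;>
      simp [h, h.ne, h.not_gt, ha, hb, hs, hs']
  · subst h
    by_cases ha : IsFirst a <;> simp [ha, hs, hs']
  · by_cases ha : IsFirst a <;> by_cases hb : IsFirst b <;>
      simp [h, h.ne', h.not_gt, ha, hb, hs, hs']

theorem hasExplicitFormula_prolong (T : CartanType) (L : Type*) [AddCommGroup L] [Module F L]
    [LieRingModule (gradeZero F n T) L] [LieModule F (gradeZero F n T) L] :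
    HasExplicitFormula F n T L (prolong T L) := by
  cases T with
  | W =>
    intro f g v
    rw [prolong_tmul, jac_W, der_sum_apply, TensorProduct.sum_tmul]
    simp only [map_sum, LinearMap.sum_apply, act_tmul]
    rfl
  | S =>
    intro k l hkl α g v
    have h : xSub α k l ((α k : F) * α l) = pderiv k (pderiv l (monomial α (1 : F))) :=
      xSub_of_ne α hkl.ne
    simp only [h, ← pderiv_pderiv_monomial]
    rw [prolong_tmul, jac_S]
    simp only [map_sum, map_sub, map_add, LinearMap.sum_apply, LinearMap.add_apply,
      LinearMap.sub_apply, act_tmul]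
    abel
  | H =>
    intro hn α g v
    rw [prolong_tmul, jac_H hn]
    simp only [map_sum, map_sub, map_add, LinearMap.sum_apply, LinearMap.add_apply,
      LinearMap.sub_apply, act_tmul, xSub_self]
    have e1 : ∀ p : {p : Fin n × Fin n // p.1 < p.2 ∧ (IsFirst p.1 ∧ IsFirst p.2)},
        xSub α p.1.1 p.1.2 ((α p.1.1 : F) * α p.1.2) = _ := fun p => xSub_of_ne α p.2.1.ne
    have e2 : ∀ p : {p : Fin n × Fin n // ¬ IsFirst p.1 ∧ IsFirst p.2},
        xSub α p.1.1 p.1.2 ((α p.1.1 : F) * α p.1.2) = _ :=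
      fun p => xSub_of_ne α fun h => p.2.1 (h ▸ p.2.2)
    have e3 : ∀ p : {p : Fin n × Fin n // p.1 < p.2 ∧ (¬ IsFirst p.1 ∧ ¬ IsFirst p.2)},
        xSub α p.1.1 p.1.2 ((α p.1.1 : F) * α p.1.2) = _ := fun p => xSub_of_ne α p.2.1.ne
    simp only [e1, e2, e3]
    abel

end ExplicitFormulas

/-! ### Generation of `U(g)` over `U(g_0)` by monomials in the `∂_i`. -/

section Enveloping

variable {F : Type*} [Field F]

/-- A linear subspace of `U(g)` that contains `1` and is stable under right multiplication by `g`
is everything. -/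
theorem submodule_eq_top_of_mul_ι {g : Type*} [LieRing g] [LieAlgebra F g]
    (N : Submodule F (UniversalEnvelopingAlgebra F g)) (h1 : 1 ∈ N)
    (h : ∀ u ∈ N, ∀ x : g, u * UniversalEnvelopingAlgebra.ι F x ∈ N) : N = ⊤ := by
  let A : Subalgebra F (UniversalEnvelopingAlgebra F g) :=
    { carrier := {a | ∀ u ∈ N, u * a ∈ N}
      mul_mem' := fun {a b} ha hb u hu => by rw [← mul_assoc]; exact hb _ (ha u hu)
      add_mem' := fun {a b} ha hb u hu => by rw [mul_add]; exact N.add_mem (ha u hu) (hb u hu)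
      algebraMap_mem' := fun c u hu => by
        rw [← Algebra.commutes, ← Algebra.smul_def]; exact N.smul_mem c hu }
  let j : g →ₗ⁅F⁆ A :=
    { toFun := fun x => ⟨UniversalEnvelopingAlgebra.ι F x, fun u hu => h u hu x⟩
      map_add' := fun x y => Subtype.ext (map_add _ x y)
      map_smul' := fun c x => Subtype.ext (map_smul _ c x)
      map_lie' := fun {x y} => Subtype.ext (LieHom.map_lie _ x y) }
  -- The elements preserving `N` by right multiplication form a subalgebra `A` containing the image
  -- of `g`. By the universal property the identity of `U(g)` factors through `A`, so `A` is
  -- everything, and `1 ∈ N` finishes.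
  have hj : A.val.comp (UniversalEnvelopingAlgebra.lift F j) = AlgHom.id F _ := by
    apply UniversalEnvelopingAlgebra.hom_ext
    ext x
    change ((UniversalEnvelopingAlgebra.lift F j (UniversalEnvelopingAlgebra.ι F x) : A) :
      UniversalEnvelopingAlgebra F g) = UniversalEnvelopingAlgebra.ι F x
    rw [UniversalEnvelopingAlgebra.lift_ι_apply]
    rfl
  rw [eq_top_iff]
  intro a _
  have h2 := (UniversalEnvelopingAlgebra.lift F j a).2 1 h1
  have h3 : ((UniversalEnvelopingAlgebra.lift F j a : A) : UniversalEnvelopingAlgebra F g) = a :=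
    DFunLike.congr_fun hj a
  rwa [one_mul, h3] at h2

/-- Here `l` has no repetitions, so exactly one factor of the ordered product absorbs `x j`. -/
theorem list_prod_mul_of_commute {ι M : Type*} [DecidableEq ι] [Monoid M] (x : ι → M)
    (hx : ∀ i j, Commute (x i) (x j)) (a : ι → ℕ) (j : ι) (l : List ι) (hl : l.Nodup)
    (hj : j ∈ l) : (l.map fun i => x i ^ a i).prod * x j =
      (l.map fun i => x i ^ (a + Pi.single j 1 : ι → ℕ) i).prod := by
  induction l with
  | nil => simp at hj
  | cons i l ih =>
    rw [List.map_cons, List.map_cons, List.prod_cons, List.prod_cons]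
    by_cases h : i = j
    · subst h
      have h1 : (l.map fun k => x k ^ (a + Pi.single i 1 : ι → ℕ) k) = l.map fun k => x k ^ a k := by
        refine List.map_congr_left fun k hk => ?_
        have : k ≠ i := fun h => (List.nodup_cons.mp hl).1 (h ▸ hk)
        simp [this]
      have h2 : Commute (x i) (l.map fun k => x k ^ a k).prod := by
        refine Commute.list_prod_right _ _ fun y hy => ?_
        obtain ⟨k, _, rfl⟩ := List.mem_map.mp hy
        exact (hx i k).pow_right _
      rw [h1, mul_assoc, ← h2.eq, ← mul_assoc, ← pow_succ]
      simp
    · have hj' : j ∈ l := (List.mem_cons.mp hj).resolve_left (Ne.symm h)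
      rw [mul_assoc, ih (List.nodup_cons.mp hl).2 hj']
      simp [h]

variable {n : ℕ} (T : CartanType)

/-- `∂_i` as an element of `g`. -/
def partialVF (i : Fin n) : vf F n T := ⟨pderiv i, pderiv_mem_vf T i⟩

theorem uPartial_eq (a : Fin n → ℕ) : uPartial F n T a = ((List.finRange n).map fun i =>
    UniversalEnvelopingAlgebra.ι F (partialVF T i) ^ a i).prod := by
  rw [uPartial, List.ofFn_eq_map]
  rfl

theorem iterPartial_eq (a : Fin n → ℕ) (f : Poly F n) : iterPartial a f =
    ((List.finRange n).map fun i => (((pderiv i : Der F n) : Poly F n →ₗ[F] Poly F n) :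
      Module.End F (Poly F n)) ^ a i).prod f := by
  rw [iterPartial, List.ofFn_eq_map]

theorem partialVF_lie (i j : Fin n) :
    ⁅(partialVF T i : vf F n T), (partialVF T j : vf F n T)⁆ = 0 := by
  apply Subtype.ext
  refine Derivation.ext fun p => ?_
  change ⁅(pderiv i : Der F n), (pderiv j : Der F n)⁆ p = 0
  rw [Derivation.commutator_apply, pderiv_comm', sub_self]

theorem ι_partialVF_commute (i j : Fin n) :
    Commute (UniversalEnvelopingAlgebra.ι F (partialVF T i : vf F n T))
      (UniversalEnvelopingAlgebra.ι F (partialVF T j : vf F n T)) := by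
  have h := congrArg (UniversalEnvelopingAlgebra.ι F) (partialVF_lie (F := F) T i j)
  rw [LieHom.map_lie, LieRing.of_associative_ring_bracket, map_zero] at h
  exact sub_eq_zero.mp h

theorem uPartial_mul (a : Fin n → ℕ) (j : Fin n) :
    uPartial F n T a * UniversalEnvelopingAlgebra.ι F (partialVF T j) =
      uPartial F n T (a + Pi.single j 1) := by
  rw [uPartial_eq, uPartial_eq]
  exact list_prod_mul_of_commute _ (ι_partialVF_commute (F := F) T) a j _ (List.nodup_finRange n)
    (List.mem_finRange j)

theorem uIncl_ι (x : filtZero F n T) : uIncl F n T (UniversalEnvelopingAlgebra.ι F x) =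
    UniversalEnvelopingAlgebra.ι F (x : vf F n T) := by
  rw [uIncl, UniversalEnvelopingAlgebra.lift_ι_apply]
  rfl

/-- `g` is the sum of `g_0` and the span of the `∂_i`. -/
theorem exists_filtZero_add (x : vf F n T) : ∃ (y : filtZero F n T) (c : Fin n → F),
    x = (y : vf F n T) + ∑ i, c i • partialVF T i := by
  refine ⟨⟨x - ∑ i, coeff 0 (x.1 (X i)) • partialVF T i, ?_⟩, fun i => coeff 0 (x.1 (X i)),
    (sub_add_cancel _ _).symm⟩
  intro j
  have h : (x - ∑ i, coeff 0 (x.1 (X i)) • (partialVF T i : vf F n T)).1 (X j) =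
      x.1 (X j) - C (coeff 0 (x.1 (X j))) := by
    change (x.1 - (∑ i, coeff 0 (x.1 (X i)) • (partialVF T i : vf F n T)).1) (X j) = _
    rw [Derivation.sub_apply, AddSubmonoidClass.coe_finsetSum, der_sum_apply]
    congr 1
    rw [Finset.sum_eq_single j]
    · change coeff 0 (x.1 (X j)) • pderiv j (X j) = _
      rw [pderiv_X_self, smul_eq_C_mul, mul_one]
    · intro i _ hi
      change coeff 0 (x.1 (X i)) • pderiv i (X j) = _
      rw [pderiv_X_of_ne hi.symm, smul_zero]
    · simp
  rw [h, coeff_sub, coeff_C, if_pos rfl, sub_self]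

/-- `U(g)` is generated by the monomials in the `∂_i` as a left `U(g_0)`-module. -/
theorem span_uIncl_mul_uPartial : Submodule.span F
    {u | ∃ b a, u = uIncl F n T b * uPartial F n T a} = ⊤ := by
  set N := Submodule.span F {u | ∃ b a, u = uIncl F n T b * uPartial F n T a} with hN
  have hleft : ∀ b, ∀ u ∈ N, uIncl F n T b * u ∈ N := by
    intro b u hu
    induction hu using Submodule.span_induction with
    | mem u hu =>
      obtain ⟨b', a, rfl⟩ := hu
      exact Submodule.subset_span ⟨b * b', a, by rw [map_mul, mul_assoc]⟩
    | zero => rw [mul_zero]; exact zero_mem _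
    | add u v _ _ hu hv => rw [mul_add]; exact add_mem hu hv
    | smul c u _ hu => rw [mul_smul_comm]; exact N.smul_mem c hu
  have hpart : ∀ a, uPartial F n T a ∈ N := fun a =>
    Submodule.subset_span ⟨1, a, by rw [map_one, one_mul]⟩
  have hright : ∀ j, ∀ u ∈ N, u * UniversalEnvelopingAlgebra.ι F (partialVF T j) ∈ N := by
    intro j u hu
    induction hu using Submodule.span_induction with
    | mem u hu =>
      obtain ⟨b, a, rfl⟩ := hu
      exact Submodule.subset_span ⟨b, a + Pi.single j 1, by rw [mul_assoc, uPartial_mul]⟩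
    | zero => rw [zero_mul]; exact zero_mem _
    | add u v _ _ hu hv => rw [add_mul]; exact add_mem hu hv
    | smul c u _ hu => rw [smul_mul_assoc]; exact N.smul_mem c hu
  have h0 : uPartial F n T 0 = 1 := by simp [uPartial_eq]
  -- This is the spanning half of Poincaré–Birkhoff–Witt, by induction on `|a|`. With `∂^a = ∂^b
  -- ∂_j`, one has `∂^a x = (∂^b x) ∂_j + ∂^b [∂_j, x]`; both terms involve the shorter monomial
  -- `∂^b` against an arbitrary field, so the induction must run over all `x`.
  have key : ∀ (k : ℕ) (a : Fin n → ℕ), ∑ i, a i = k → ∀ x : vf F n T,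
      uPartial F n T a * UniversalEnvelopingAlgebra.ι F x ∈ N := by
    intro k
    induction k with
    | zero =>
      intro a ha x
      have ha' : a = 0 := by
        funext i
        exact (Finset.sum_eq_zero_iff.mp ha) i (Finset.mem_univ i)
      rw [ha', h0, one_mul]
      obtain ⟨y, c, rfl⟩ := exists_filtZero_add T x
      rw [map_add, map_sum, ← uIncl_ι]
      refine add_mem ?_ (N.sum_mem fun i _ => ?_)
      · have := hleft (UniversalEnvelopingAlgebra.ι F y) _ (hpart 0)
        rwa [h0, mul_one] at this
      · rw [map_smul]
        refine N.smul_mem _ ?_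
        have := hright i _ (hpart 0)
        rwa [h0, one_mul] at this
    | succ k ih =>
      intro a ha x
      obtain ⟨j, hj⟩ : ∃ j, a j ≠ 0 := by
        by_contra! h
        simp [h] at ha
      have hle : Pi.single j 1 ≤ a := by
        intro i
        by_cases h : i = j
        · subst h; simpa using Nat.one_le_iff_ne_zero.mpr hj
        · simp [h]
      have ha' : a - Pi.single j 1 + Pi.single j 1 = a := tsub_add_cancel_of_le hle
      have hs : ∑ i, (a - Pi.single j 1 : Fin n → ℕ) i = k := by
        have h1 : ∑ i, (a - Pi.single j 1 + Pi.single j 1 : Fin n → ℕ) i = k + 1 := by rw [ha', ha]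
        simp only [Pi.add_apply, Finset.sum_add_distrib, Finset.sum_pi_single', Finset.mem_univ,
          if_true] at h1
        exact Nat.add_right_cancel h1
      have hc : UniversalEnvelopingAlgebra.ι F (partialVF T j : vf F n T) *
          UniversalEnvelopingAlgebra.ι F x =
          UniversalEnvelopingAlgebra.ι F x *
            UniversalEnvelopingAlgebra.ι F (partialVF T j : vf F n T) +
            UniversalEnvelopingAlgebra.ι F ⁅(partialVF T j : vf F n T), x⁆ := by
        rw [LieHom.map_lie, LieRing.of_associative_ring_bracket]
        abel
      rw [← ha', ← uPartial_mul, mul_assoc, hc, mul_add, ← mul_assoc]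
      exact add_mem (hright j _ (ih _ hs x)) (ih _ hs _)
  refine submodule_eq_top_of_mul_ι N (h0 ▸ hpart 0) fun u hu x => ?_
  induction hu using Submodule.span_induction with
  | mem u hu =>
    obtain ⟨b, a, rfl⟩ := hu
    rw [mul_assoc]
    exact hleft b _ (key _ a rfl x)
  | zero => rw [zero_mul]; exact zero_mem _
  | add u v _ _ hu hv => rw [add_mul]; exact add_mem hu hv
  | smul c u _ hu => rw [smul_mul_assoc]; exact N.smul_mem c hu

theorem eq_of_eq_on_uPartial {L : Type*} [AddCommGroup L] [Module F L]
    [LieRingModule (gradeZero F n T) L] [LieModule F (gradeZero F n T) L]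
    {f g : U F n T →ₗ[F] L} (hf : ∀ a u, f (uIncl F n T a * u) = uRep F n T L a (f u))
    (hg : ∀ a u, g (uIncl F n T a * u) = uRep F n T L a (g u))
    (h : ∀ a, f (uPartial F n T a) = g (uPartial F n T a)) : f = g := by
  refine LinearMap.ext_on (span_uIncl_mul_uPartial T) ?_
  rintro _ ⟨b, a, rfl⟩
  rw [hf, hg, h]

variable {T}

theorem uPartial_mem_uGrade (a : Fin n → ℕ) :
    uPartial F n T a ∈ uGrade F n T (-((∑ i, a i : ℕ) : ℤ)) := by
  have hd : ∀ i : Fin n, (partialVF T i : vf F n T) ∈ grade F n T (-1) := by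
    intro i j m h
    change coeff m (pderiv i (X j : Poly F n)) ≠ 0 at h
    have : m = 0 := by
      by_contra h1
      apply h
      rw [pderiv_X, Pi.single_apply]
      split_ifs
      · rw [coeff_one, if_neg (Ne.symm h1)]
      · rw [coeff_zero]
    simp [this]
  have h1 : ∀ (d : ℤ) (u : U F n T) (i : Fin n) (k : ℕ), u ∈ uGrade F n T d →
      u * UniversalEnvelopingAlgebra.ι F (partialVF T i) ^ k ∈ uGrade F n T (d - k) := by
    intro d u i k hu
    induction k with
    | zero => simpa using hu
    | succ k ih =>
      rw [pow_succ, ← mul_assoc]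
      have := mul_ι_mem_uGrade T ih (hd i)
      rwa [show d - k + -1 = d - (k + 1 : ℕ) by push_cast; ring] at this
  have h2 : ∀ (l : List (Fin n)) (d : ℤ) (u : U F n T), u ∈ uGrade F n T d →
      u * (l.map fun i => UniversalEnvelopingAlgebra.ι F (partialVF T i) ^ a i).prod ∈
        uGrade F n T (d - ((l.map a).sum : ℕ)) := by
    intro l
    induction l with
    | nil => intro d u hu; simpa using hu
    | cons i l ih =>
      intro d u hu
      have := ih _ _ (h1 d u i (a i) hu)
      rw [List.map_cons, List.map_cons, List.prod_cons, List.sum_cons, ← mul_assoc]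
      rwa [show d - (a i : ℤ) - ((l.map a).sum : ℕ) = d - (a i + (l.map a).sum : ℕ) by
        push_cast; ring] at this
  have h3 := h2 (List.finRange n) 0 1 (Submodule.subset_span ⟨[], by simp, rfl, by simp⟩)
  rwa [one_mul, ← uPartial_eq, zero_sub, ← List.ofFn_eq_map, List.sum_ofFn] at h3

end Enveloping

/-! ### Gradation of `P_n ⊗ L` and evaluation at the origin. -/

section Homogeneous

variable (F : Type*) [Field F] (n : ℕ)

/-- The homogeneous polynomials of degree `d`, for an integer `d`. -/
def polyGrade (d : ℤ) : Submodule F (Poly F n) where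
  carrier := {p | ∀ m, coeff m p ≠ 0 → (m.degree : ℤ) = d}
  zero_mem' := by intro m h; simp at h
  add_mem' := by
    intro p q hp hq m h
    by_cases h1 : coeff m p = 0
    · refine hq m fun h2 => h ?_
      rw [coeff_add, h1, h2, add_zero]
    · exact hp m h1
  smul_mem' := by
    intro c p hp m h
    refine hp m fun h1 => h ?_
    rw [coeff_smul, h1, smul_zero]

variable {F n}

theorem monomial_mem_polyGrade (m : Fin n →₀ ℕ) (c : F) :
    monomial m c ∈ polyGrade F n m.degree := by
  intro k h
  rw [coeff_monomial] at h
  have : m = k := by by_contra h1; simp [h1] at h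
  rw [this]

theorem mul_mem_polyGrade {d e : ℤ} {p q : Poly F n} (hp : p ∈ polyGrade F n d)
    (hq : q ∈ polyGrade F n e) : p * q ∈ polyGrade F n (d + e) := by
  intro m h
  rw [coeff_mul] at h
  obtain ⟨⟨a, b⟩, hab, hne⟩ := Finset.exists_ne_zero_of_sum_ne_zero h
  rw [Finset.HasAntidiagonal.mem_antidiagonal] at hab
  rw [← hab, map_add, Nat.cast_add, hp a (left_ne_zero_of_mul hne),
    hq b (right_ne_zero_of_mul hne)]

theorem pderiv_mem_polyGrade {d : ℤ} {p : Poly F n} (hp : p ∈ polyGrade F n d) (i : Fin n) :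
    pderiv i p ∈ polyGrade F n (d - 1) := by
  intro m h
  rw [coeff_pderiv] at h
  have := hp _ (left_ne_zero_of_mul h)
  simp only [map_add, Finsupp.degree_single, Nat.cast_add, Nat.cast_one] at this
  omega

theorem der_mem_polyGrade {d e : ℤ} {D : Der F n} {p : Poly F n} (hD : D ∈ derGrade F n e)
    (hp : p ∈ polyGrade F n d) : D p ∈ polyGrade F n (d + e) := by
  rw [der_apply]
  refine Submodule.sum_mem _ fun i _ => ?_
  have h : D (X i) ∈ polyGrade F n (e + 1) := hD i
  have := mul_mem_polyGrade h (pderiv_mem_polyGrade hp i)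
  rwa [show e + 1 + (d - 1) = d + e by ring] at this

variable (F n) in
/-- The homogeneous elements of degree `d` of `P_n ⊗ L`. -/
def tensorGrade (L : Type*) [AddCommGroup L] [Module F L] (d : ℤ) :
    Submodule F (Poly F n ⊗[F] L) :=
  Submodule.span F {t | ∃ p ∈ polyGrade F n d, ∃ v : L, t = p ⊗ₜ v}

variable {T : CartanType} {L : Type*} [AddCommGroup L] [Module F L]

theorem tmul_mem_tensorGrade {d : ℤ} {p : Poly F n} (hp : p ∈ polyGrade F n d) (v : L) :
    p ⊗ₜ v ∈ tensorGrade F n L d :=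
  Submodule.subset_span ⟨p, hp, v, rfl⟩

variable (F n L) in
/-- The evaluation `g ⊗ v ↦ g(0) v`. -/
def evalZero : Poly F n ⊗[F] L →ₗ[F] L :=
  TensorProduct.lid F L ∘ₗ LinearMap.rTensor L (lcoeff F 0)

@[simp]
theorem evalZero_tmul (p : Poly F n) (v : L) : evalZero F n L (p ⊗ₜ v) = coeff 0 p • v := rfl

theorem evalZero_eq_zero {d : ℤ} (hd : d ≠ 0) {m : Poly F n ⊗[F] L}
    (hm : m ∈ tensorGrade F n L d) : evalZero F n L m = 0 := by
  have h : tensorGrade F n L d ≤ LinearMap.ker (evalZero F n L) := by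
    refine Submodule.span_le.mpr ?_
    rintro _ ⟨p, hp, v, rfl⟩
    have : coeff 0 p = 0 := by
      by_contra h
      exact hd (by simpa using (hp 0 h).symm)
    change evalZero F n L (p ⊗ₜ v) = 0
    rw [evalZero_tmul, this, zero_smul]
  exact h hm

variable [LieRingModule (gradeZero F n T) L] [LieModule F (gradeZero F n T) L]

theorem act_jac_tmul (D : vf F n T) (g : Poly F n) (v : L) : act F n T L (jac T D) (g ⊗ₜ v) =
    ∑ β ∈ jacSupport D.1, (monomial β 1 * g) ⊗ₜ ⁅lin T β D, v⁆ := by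
  rw [jac, map_sum, LinearMap.sum_apply]
  rfl

theorem prolong_mem_tensorGrade {d e : ℤ} {D : vf F n T} (hD : D ∈ grade F n T e)
    {m : Poly F n ⊗[F] L} (hm : m ∈ tensorGrade F n L d) :
    prolong T L D m ∈ tensorGrade F n L (d + e) := by
  have h : tensorGrade F n L d ≤ (tensorGrade F n L (d + e)).comap (prolong T L D) := by
    refine Submodule.span_le.mpr ?_
    rintro _ ⟨p, hp, v, rfl⟩
    change prolong T L D (p ⊗ₜ v) ∈ tensorGrade F n L (d + e)
    rw [prolong_tmul, act_jac_tmul]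
    refine add_mem (tmul_mem_tensorGrade (der_mem_polyGrade hD hp) v)
      (Submodule.sum_mem _ fun β hβ => tmul_mem_tensorGrade ?_ _)
    simp only [jacSupport, Finset.mem_biUnion, Finset.mem_univ, true_and] at hβ
    obtain ⟨i, j, hβ⟩ := hβ
    have h1 : D.1 (X i) ∈ polyGrade F n (e + 1) := hD i
    have h2 := pderiv_mem_polyGrade h1 j β (mem_support_iff.mp hβ)
    have h3 := mul_mem_polyGrade (monomial_mem_polyGrade β (1 : F)) hp
    rwa [h2, show e + 1 - 1 + d = d + e by ring] at h3
  exact h hm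

/-- The components of `x` vanish at the origin, so `x(g)(0) = 0`, and among the factors `x^β` only
`β = 0` survives. The remaining linear field is the linear part of `x`, which is `projZero`. -/
theorem evalZero_prolong (x : filtZero F n T) (m : Poly F n ⊗[F] L) :
    evalZero F n L (prolong T L (x : vf F n T) m) = ⁅projZero F n T x, evalZero F n L m⁆ := by
  induction m with
  | zero => simp
  | add a b ha hb => rw [map_add, map_add, ha, hb, map_add, lie_add]
  | tmul g v =>
    have h0 : coeff 0 ((x : vf F n T).1 g) = 0 := by
      rw [der_apply, coeff_sum]
      refine Finset.sum_eq_zero fun i _ => ?_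
      have := x.2 i
      change constantCoeff _ = 0
      change constantCoeff _ = 0 at this
      rw [map_mul, this, zero_mul]
    rw [prolong_tmul, act_jac_tmul, map_add, map_sum, evalZero_tmul, h0, zero_smul, zero_add,
      Finset.sum_eq_single 0]
    · rw [evalZero_tmul, evalZero_tmul, lie_smul, monomial_zero', C_1, one_mul]
      rfl
    · intro β _ hβ
      rw [evalZero_tmul, coeff_monomial_mul', if_neg, zero_smul]
      simpa using hβ
    -- If `0` is missing from `jacSupport`, the term `β = 0` is absent from the sum, but then the
    -- linear part of `x` is zero.
    · intro h
      have : lin T 0 (x : vf F n T) = 0 := by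
        apply Subtype.ext; apply Subtype.ext; apply derivation_ext
        intro i
        change derLin 0 x.1.1 (X i) = 0
        rw [derLin_X]
        refine Finset.sum_eq_zero fun j _ => ?_
        simp only [jacSupport, Finset.mem_biUnion, Finset.mem_univ, true_and, not_exists,
          notMem_support_iff] at h
        rw [h i j, C_0, zero_mul]
      rw [this, zero_lie, TensorProduct.tmul_zero, map_zero]

end Homogeneous

/-! ### The isomorphism with the costandard module. -/

section Costandard

variable {F : Type*} [Field F] [CharZero F] {n : ℕ} {T : CartanType} {L : Type*} [AddCommGroup L]
  [Module F L] [LieRingModule (gradeZero F n T) L] [LieModule F (gradeZero F n T) L]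

variable (F n T L) in
/-- The action of `U(g)` on `P_n ⊗ L`. -/
def uAct : U F n T →ₐ[F] Module.End F (Poly F n ⊗[F] L) :=
  UniversalEnvelopingAlgebra.lift F (prolongHom F n T L)

theorem uAct_ι (x : vf F n T) :
    uAct F n T L (UniversalEnvelopingAlgebra.ι F x) = prolong T L x := by
  rw [uAct, UniversalEnvelopingAlgebra.lift_ι_apply]
  rfl

variable (F n T L) in
/-- The map `m ↦ (u ↦ (u m)(0))` from `P_n ⊗ L` to the linear maps `U(g) → L`. -/
def toHom : Poly F n ⊗[F] L →ₗ[F] U F n T →ₗ[F] L :=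
  (uAct F n T L).toLinearMap.flip.compr₂ (evalZero F n L)

theorem toHom_apply (m : Poly F n ⊗[F] L) (u : U F n T) :
    toHom F n T L m u = evalZero F n L (uAct F n T L u m) := rfl

theorem toHom_prolong (x : vf F n T) (m : Poly F n ⊗[F] L) (u : U F n T) :
    toHom F n T L (prolong T L x m) u =
      toHom F n T L m (u * UniversalEnvelopingAlgebra.ι F x) := by
  rw [toHom_apply, toHom_apply, map_mul, uAct_ι, Module.End.mul_apply]

theorem evalZero_uAct_uIncl (a : UniversalEnvelopingAlgebra F (filtZero F n T))
    (m : Poly F n ⊗[F] L) :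
    evalZero F n L (uAct F n T L (uIncl F n T a) m) = uRep F n T L a (evalZero F n L m) := by
  let N : Submodule F (UniversalEnvelopingAlgebra F (filtZero F n T)) :=
    { carrier := {a | ∀ m : Poly F n ⊗[F] L, evalZero F n L (uAct F n T L (uIncl F n T a) m) =
        uRep F n T L a (evalZero F n L m)}
      zero_mem' := by intro m; simp
      add_mem' := by
        intro a b ha hb m
        simp only [map_add, LinearMap.add_apply, ha m, hb m]
      smul_mem' := by
        intro c a ha m
        simp only [map_smul, LinearMap.smul_apply, ha m] }
  have hN : N = ⊤ := by
    refine submodule_eq_top_of_mul_ι N (fun m => ?_) fun a ha x m => ?_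
    · simp
    · rw [map_mul, map_mul, map_mul, uIncl_ι, uAct_ι, Module.End.mul_apply, Module.End.mul_apply,
        ha, evalZero_prolong]
      congr 1
      rw [uRep, UniversalEnvelopingAlgebra.lift_ι_apply]
      rfl
  have : a ∈ N := hN ▸ Submodule.mem_top
  exact this m

theorem toHom_uIncl (m : Poly F n ⊗[F] L) (a : UniversalEnvelopingAlgebra F (filtZero F n T))
    (u : U F n T) :
    toHom F n T L m (uIncl F n T a * u) = uRep F n T L a (toHom F n T L m u) := by
  rw [toHom_apply, toHom_apply, map_mul, Module.End.mul_apply, evalZero_uAct_uIncl]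

theorem uAct_mem_tensorGrade {d j : ℤ} {u : U F n T} (hu : u ∈ uGrade F n T j)
    {m : Poly F n ⊗[F] L} (hm : m ∈ tensorGrade F n L d) :
    uAct F n T L u m ∈ tensorGrade F n L (d + j) := by
  induction hu using Submodule.span_induction with
  | mem u hu =>
    obtain ⟨l, h1, rfl, rfl⟩ := hu
    induction l with
    | nil => simpa using hm
    | cons p l ih =>
      rw [List.map_cons, List.map_cons, List.prod_cons, List.sum_cons, map_mul, uAct_ι,
        Module.End.mul_apply, add_comm p.1, ← add_assoc]
      exact prolong_mem_tensorGrade (h1 p (List.mem_cons_self ..))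
        (ih fun q hq => h1 q (List.mem_cons_of_mem _ hq))
  | zero => simp
  | add u v _ _ hu hv => rw [map_add]; exact add_mem hu hv
  | smul c u _ hu => rw [map_smul]; exact Submodule.smul_mem _ c hu

/-- An element `u` of degree `j` carries `m` to degree `d + j`, where evaluation at `0` vanishes
unless `j = -d`. -/
theorem toHom_mem_costandardGrade {d : ℤ} {m : Poly F n ⊗[F] L}
    (hm : m ∈ tensorGrade F n L d) : toHom F n T L m ∈ costandardGrade F n T L d := by
  refine ⟨toHom_uIncl m, fun j hj u hu => ?_⟩
  exact evalZero_eq_zero (fun h => hj (by omega)) (uAct_mem_tensorGrade hu hm)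

theorem toHom_mem_costandard (m : Poly F n ⊗[F] L) :
    toHom F n T L m ∈ costandard F n T L := by
  induction m with
  | zero => rw [map_zero]; exact zero_mem _
  | add a b ha hb => rw [map_add]; exact add_mem ha hb
  | tmul g v =>
    rw [as_sum g, TensorProduct.sum_tmul, map_sum]
    exact Submodule.sum_mem _ fun γ _ => Submodule.mem_iSup_of_mem _
      (toHom_mem_costandardGrade (tmul_mem_tensorGrade (monomial_mem_polyGrade γ _) v))

theorem prolong_partialVF (i : Fin n) : prolong T L (partialVF T i) =
    LinearMap.rTensor L ((pderiv i : Der F n) : Poly F n →ₗ[F] Poly F n) := by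
  have h : jac T (partialVF T i : vf F n T) = 0 := by
    rw [jac_eq_iff]
    intro a b
    change _ = pderiv b (pderiv i (X a))
    rw [pderiv_X, Pi.single_apply, map_zero]
    split_ifs <;> simp
  refine LinearMap.ext fun m => ?_
  rw [prolong_apply, h, map_zero, LinearMap.zero_apply, add_zero]
  rfl

theorem uAct_uPartial (a : Fin n → ℕ) (f : Poly F n) (v : L) :
    uAct F n T L (uPartial F n T a) (f ⊗ₜ v) = iterPartial a f ⊗ₜ v := by
  have h : ∀ l : List (Fin n), uAct F n T L
      (l.map fun i => UniversalEnvelopingAlgebra.ι F (partialVF T i) ^ a i).prod =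
      LinearMap.rTensor L (l.map fun i => (((pderiv i : Der F n) : Poly F n →ₗ[F] Poly F n) :
        Module.End F (Poly F n)) ^ a i).prod := by
    intro l
    induction l with
    | nil => rw [List.map_nil, List.map_nil, List.prod_nil, List.prod_nil, map_one]
             exact (LinearMap.rTensor_id L (Poly F n)).symm
    | cons i l ih =>
      rw [List.map_cons, List.map_cons, List.prod_cons, List.prod_cons, map_mul, ih, map_pow,
        uAct_ι, prolong_partialVF, LinearMap.rTensor_pow, LinearMap.rTensor_mul]
  rw [uPartial_eq, h, LinearMap.rTensor_tmul, iterPartial_eq]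

theorem toHom_tmul_uPartial (a : Fin n → ℕ) (f : Poly F n) (v : L) :
    toHom F n T L (f ⊗ₜ v) (uPartial F n T a) = constantCoeff (iterPartial a f) • v := by
  rw [toHom_apply, uAct_uPartial]
  rfl

/-- The constant is `∏ a_i!`. It is built as a nonzero natural number, so that characteristic `0` is
needed only when it is cast to `F`. -/
theorem exists_coeff_iterPartial (a : Fin n → ℕ) : ∃ c : F, c ≠ 0 ∧ ∀ f : Poly F n,
    constantCoeff (iterPartial a f) = c * coeff (Finsupp.equivFunOnFinite.symm a) f := by
  have h1 : ∀ (i : Fin n) (k : ℕ) (m : Fin n →₀ ℕ), ∃ c : ℕ, c ≠ 0 ∧ ∀ f : Poly F n,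
      coeff m (((((pderiv i : Der F n) : Poly F n →ₗ[F] Poly F n) :
        Module.End F (Poly F n)) ^ k) f) = c * coeff (m + Finsupp.single i k) f := by
    intro i k
    induction k with
    | zero => exact fun m => ⟨1, one_ne_zero, fun f => by simp⟩
    | succ k ih =>
      intro m
      obtain ⟨c, hc, h⟩ := ih (m + Finsupp.single i 1)
      refine ⟨c * (m i + 1), mul_ne_zero hc (Nat.succ_ne_zero _), fun f => ?_⟩
      rw [pow_succ', Module.End.mul_apply]
      change coeff m (pderiv i _) = _
      rw [coeff_pderiv, h, add_assoc, ← Finsupp.single_add, add_comm 1 k]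
      push_cast
      ring
  have h2 : ∀ (l : List (Fin n)) (m : Fin n →₀ ℕ), ∃ c : ℕ, c ≠ 0 ∧ ∀ f : Poly F n,
      coeff m ((l.map fun i => (((pderiv i : Der F n) : Poly F n →ₗ[F] Poly F n) :
        Module.End F (Poly F n)) ^ a i).prod f) =
        c * coeff (m + (l.map fun i => Finsupp.single i (a i)).sum) f := by
    intro l
    induction l with
    | nil => exact fun m => ⟨1, one_ne_zero, fun f => by simp⟩
    | cons i l ih =>
      intro m
      obtain ⟨c, hc, h⟩ := h1 i (a i) m
      obtain ⟨c', hc', h'⟩ := ih (m + Finsupp.single i (a i))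
      refine ⟨c * c', mul_ne_zero hc hc', fun f => ?_⟩
      rw [List.map_cons, List.map_cons, List.prod_cons, List.sum_cons, Module.End.mul_apply, h, h',
        add_assoc]
      push_cast
      ring
  obtain ⟨c, hc, h⟩ := h2 (List.finRange n) 0
  refine ⟨c, Nat.cast_ne_zero.mpr hc, fun f => ?_⟩
  have h3 : ((List.finRange n).map fun i => Finsupp.single i (a i)).sum =
      Finsupp.equivFunOnFinite.symm a := by
    rw [← List.ofFn_eq_map, List.sum_ofFn]
    ext j
    simp [Finsupp.finsetSum_apply, Finsupp.single_apply]
  rw [iterPartial_eq, ← h3, ← zero_add (List.sum _)]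
  exact h f

variable (F n L) in
/-- The coefficients in `L` of the elements of `P_n ⊗ L`. -/
def coeffEquiv : Poly F n ⊗[F] L ≃ₗ[F] (Fin n →₀ ℕ) →₀ L :=
  TensorProduct.equivFinsuppOfBasisLeft (basisMonomials (Fin n) F)

theorem exists_toHom_uPartial (γ : Fin n →₀ ℕ) : ∃ c : F, c ≠ 0 ∧ ∀ m : Poly F n ⊗[F] L,
    toHom F n T L m (uPartial F n T γ) = c • coeffEquiv F n L m γ := by
  obtain ⟨c, hc, h⟩ := exists_coeff_iterPartial (F := F) γ
  refine ⟨c, hc, fun m => ?_⟩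
  induction m with
  | zero => simp
  | add a b ha hb => rw [map_add, LinearMap.add_apply, ha, hb, map_add, Finsupp.add_apply, smul_add]
  | tmul g v =>
    have h1 : coeffEquiv F n L (g ⊗ₜ v) γ = coeff γ g • v :=
      TensorProduct.equivFinsuppOfBasisLeft_apply_tmul_apply _ _ _ _
    rw [toHom_tmul_uPartial, h, h1, smul_smul]
    congr 3
    ext i
    rfl

theorem toHom_injective : Function.Injective (toHom F n T L) := by
  rw [← LinearMap.ker_eq_bot, LinearMap.ker_eq_bot']
  intro m hm
  apply (coeffEquiv F n L).injective
  ext γ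
  obtain ⟨c, hc, h⟩ := exists_toHom_uPartial (F := F) (T := T) (L := L) γ
  have h1 := h m
  rw [hm, LinearMap.zero_apply] at h1
  rw [map_zero, Finsupp.zero_apply]
  exact (smul_eq_zero.mp h1.symm).resolve_left hc

theorem costandard_le_range : costandard F n T L ≤ LinearMap.range (toHom F n T L) := by
  refine iSup_le fun i f hf => ?_
  choose c hc h using exists_toHom_uPartial (F := F) (T := T) (L := L) (n := n)
  -- The preimage has `x^γ` coefficient `f(∂^γ)/c_γ`. Since `∂^γ` has degree `-|γ|` and `f` lives in
  -- degree `-i`, only the finitely many `γ` with `|γ| = i` occur. For `i < 0` there are none, and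
  -- the default `i.toNat = 0` does no harm.
  have hsupp : ∀ γ : Fin n →₀ ℕ, (c γ)⁻¹ • f (uPartial F n T γ) ≠ 0 →
      γ ∈ Finset.univ.finsuppAntidiag i.toNat := by
    intro γ hγ
    rw [Finset.mem_finsuppAntidiag]
    refine ⟨?_, Finset.subset_univ _⟩
    by_contra h1
    apply hγ
    rw [hf.2 _ (fun h2 => h1 ?_) _ (uPartial_mem_uGrade γ), smul_zero]
    have h3 : ((∑ j, γ j : ℕ) : ℤ) = i := neg_injective h2
    rw [← h3, Int.toNat_natCast]
  refine ⟨(coeffEquiv F n L).symm (Finsupp.onFinset _ _ hsupp), ?_⟩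
  -- Both functionals are `U(g_0)`-linear, so agreement on the monomials `∂^a` suffices.
  refine eq_of_eq_on_uPartial T (toHom_uIncl _) hf.1 fun a => ?_
  have := h (Finsupp.equivFunOnFinite.symm a)
    ((coeffEquiv F n L).symm (Finsupp.onFinset _ _ hsupp))
  rwa [LinearEquiv.apply_symm_apply, Finsupp.onFinset_apply, smul_smul, mul_inv_cancel₀ (hc _),
    one_smul] at this

variable (F n T L) in
/-- The isomorphism of `P_n ⊗ L` with the costandard module. -/
def costandardEquiv : Poly F n ⊗[F] L ≃ₗ[F] costandard F n T L :=
  LinearEquiv.ofBijective ((toHom F n T L).codRestrict _ toHom_mem_costandard)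
    ⟨fun _ _ h => toHom_injective (congrArg Subtype.val h), fun f =>
      let ⟨m, hm⟩ := costandard_le_range f.2
      ⟨m, Subtype.ext hm⟩⟩

end Costandard

end

end CartanVF

theorem mainTheorem7 {F : Type*} [Field F] [IsAlgClosed F] [CharZero F] (n : ℕ) (hn : 0 < n)
    (T : CartanVF.CartanType) (hT : T = CartanVF.CartanType.H → Even n)
    (lam : Module.Dual F (CartanVF.cartan F n T)) (hlam : CartanVF.IsAntidominant T lam)
    (L : Type*) [AddCommGroup L] [Module F L]
    [LieRingModule (CartanVF.gradeZero F n T) L] [LieModule F (CartanVF.gradeZero F n T) L]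
    (hirr : LieModule.IsIrreducible F (CartanVF.gradeZero F n T) L)
    (hlow : CartanVF.HasLowestWeight T lam L) :
    ∃ ρ : CartanVF.vf F n T →ₗ⁅F⁆ Module.End F (CartanVF.Poly F n ⊗[F] L),
      (∀ D, ρ D = CartanVF.prolong T L D) ∧
      CartanVF.HasExplicitFormula F n T L ρ ∧
      ∃ ψ : CartanVF.Poly F n ⊗[F] L ≃ₗ[F] CartanVF.costandard F n T L,
        (∀ (D : CartanVF.vf F n T) (m : CartanVF.Poly F n ⊗[F] L), ψ (ρ D m) = ⁅D, ψ m⁆) ∧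
        ∀ (f : CartanVF.Poly F n) (v : L) (a : Fin n → ℕ),
          (ψ (f ⊗ₜ[F] v)).1 (CartanVF.uPartial F n T a) =
            constantCoeff (CartanVF.iterPartial a f) • v := by
  refine ⟨CartanVF.prolongHom F n T L, fun D => rfl, CartanVF.hasExplicitFormula_prolong T L,
    CartanVF.costandardEquiv F n T L, fun D m => ?_, fun f v a => ?_⟩
  · apply Subtype.ext
    apply LinearMap.ext
    intro u
    exact CartanVF.toHom_prolong D m u
  · exact CartanVF.toHom_tmul_uPartial a f v
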